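/- For $k\in\mathbb{N}$ with $k\ge 1$, let $W_k=C_2\wr C_{2^k}=B_k\rtimes\langle \dot x_k\rangle$ be the regular wreath product with cyclic top group $\langle\dot x_k\rangle\cong C_{2^k}$ and base group $B_k=\prod_{i=0}^{2^k-1}\langle \dot y_k^{\,\dot x_k^{\,i}}\rangle\cong C_2^{\,2^k}$. Let $F_2=\langle a,b\rangle$ be the free pro-$2$ group on two generators $a,b$, let $R_k$ be the kernel of the continuous epimorphism $F_2\to W_k$ with $a\mapsto\dot x_k$, $b\mapsto\dot y_k$, and let $Y_k$ be the pre-image of $B_k$ in $F_2$. Let $N_k=[R_k,Y_k]\,R_k^{\,2}\,\langle a^{2^k}\rangle^{F_2}$ (a closed normal subgroup of $F_2$), where $\langle a^{2^k}\rangle^{F_2}$ denotes the normal closure, and put $G_k=F_2/N_k$. This is a finite $2$-group; let $x_k,y_k\in G_k$ be the images of $a,b$. Write $[g,h]=g^{-1}h^{-1}gh$ with left-normed iterated commutators, $c_1=y_k$ and $c_i=[c_{i-1},x_k]=[y_k,x_k,\overset{i-1}{\ldots},x_k]$ for $i\ge 2$. Let $\gamma_1(G_k)=G_k$ and $\gamma_i(G_k)=[\gamma_{i-1}(G_k),G_k]$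 for $i\ge2$ be the lower central series, and let $P_1(G_k)=G_k$ and $P_i(G_k)=P_{i-1}(G_k)^2\,[P_{i-1}(G_k),G_k]$ for $i\ge 2$ be the lower $2$-series, where $P^2$ is the subgroup generated by the squares of the elements of $P$. The length of the lower $2$-series is the least $n$ with $P_{n+1}(G_k)=1$. Then the length of the lower $2$-series of $G_k$ is $2^{k+1}-1$, and \begin{align*} P_1(G_k)&=G_k,\\ P_2(G_k)&=\langle x_k^{\,2},y_k^{\,2}\rangle\,\gamma_2(G_k),\\ P_i(G_k)&=\langle x_k^{\,2^{i-1}},c_{i-1}^{\,2}\rangle\,\gamma_i(G_k)&&\text{for }3\le i\le 2^{k-1}+1,\\ P_i(G_k)&=\langle x_k^{\,2^{i-1}}\rangle\,\gamma_i(G_k)&&\text{for }2^{k-1}+2\le i\le 2^{k+1}. \end{align*} -/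

import Mathlib

noncomputable section

namespace ProTwo

/-! ## The free pro-`2` group on two generators -/

/-- The abstract free group on two generators. -/
abbrev E : Type := FreeGroup (Fin 2)

/-- The normal subgroups of `E` whose index is a power of `2`. -/
abbrev TwoPowerNormal : Type :=
  {N : Subgroup E // N.Normal ∧ ∃ m : ℕ, N.index = 2 ^ m}

instance (N : TwoPowerNormal) : N.1.Normal := N.2.1

/-- The finite quotients `E ⧸ N` carry the discrete topology. -/
instance (N : TwoPowerNormal) : TopologicalSpace (E ⧸ N.1) := ⊥

instance (N : TwoPowerNormal) : DiscreteTopology (E ⧸ N.1) := ⟨rfl⟩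

/-- The free pro-`2` group `F₂` on two generators: the inverse limit of the finite `2`-groups
`E ⧸ N`, as the subgroup of compatible families in the product of these groups. -/
def freeProTwo : Subgroup (∀ N : TwoPowerNormal, E ⧸ N.1) where
  carrier := {f | ∀ (M N : TwoPowerNormal) (h : M.1 ≤ N.1),
    QuotientGroup.map M.1 N.1 (MonoidHom.id E) h (f M) = f N}
  mul_mem' := by
    intro f g hf hg M N h
    simp only [Pi.mul_apply, map_mul, hf M N h, hg M N h]
  one_mem' := by
    intro M N h
    simp only [Pi.one_apply, map_one]
  inv_mem' := by
    intro f hf M N h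
    simp only [Pi.inv_apply, map_inv, hf M N h]

/-- `F₂` as a topological group: its topology is the subspace topology of the product topology. -/
abbrev F : Type := freeProTwo

/-- The canonical homomorphism from the abstract free group to `F₂`. -/
def ι : E →* F where
  toFun w := ⟨fun _ => (w : E ⧸ _), fun _ _ _ => rfl⟩
  map_one' := rfl
  map_mul' _ _ := rfl

/-- The first free generator of `F₂`. -/
def a : F := ι (FreeGroup.of 0)

/-- The second free generator of `F₂`. -/
def b : F := ι (FreeGroup.of 1)

lemma index_ker_two_power {P : Type*} [Group P] [Finite P] (hP : IsPGroup 2 P) (φ : E →* P) :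
    ∃ m : ℕ, φ.ker.index = 2 ^ m := by
  have : Fact (Nat.Prime 2) := ⟨Nat.prime_two⟩
  rw [Subgroup.index_ker]
  exact IsPGroup.iff_card.mp (hP.to_subgroup φ.range)

/-- The kernel of a homomorphism from `E` to a finite `2`-group. -/
def kerTwo {P : Type*} [Group P] [Finite P] (hP : IsPGroup 2 P) (φ : E →* P) : TwoPowerNormal :=
  ⟨φ.ker, inferInstance, index_ker_two_power hP φ⟩

/-- The continuous extension to `F₂` of a homomorphism from `E` to a finite `2`-group. -/
def lift {P : Type*} [Group P] [Finite P] (hP : IsPGroup 2 P) (φ : E →* P) : F →* P :=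
  (QuotientGroup.kerLift φ).comp
    ((Pi.evalMonoidHom (fun N : TwoPowerNormal => E ⧸ N.1) (kerTwo hP φ)).comp freeProTwo.subtype)

lemma lift_ι {P : Type*} [Group P] [Finite P] (hP : IsPGroup 2 P) (φ : E →* P) (w : E) :
    lift hP φ (ι w) = φ w := rfl

lemma isOpen_ker_lift {P : Type*} [Group P] [Finite P] (hP : IsPGroup 2 P) (φ : E →* P) :
    IsOpen ((lift hP φ).ker : Set F) := by
  have hc : Continuous fun f : F => f.1 (kerTwo hP φ) :=
    (continuous_apply (kerTwo hP φ)).comp continuous_subtype_val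
  exact (isOpen_discrete (α := E ⧸ (kerTwo hP φ).1)
    {q | QuotientGroup.kerLift φ q = 1}).preimage hc

/-! ## The finite wreath products `W_k` -/

/-- `W_k = C₂ ≀ C_{2^k}`, the regular wreath product with top group cyclic of order `2 ^ k`. -/
abbrev W (k : ℕ) : Type :=
  RegularWreathProduct (Multiplicative (ZMod 2)) (Multiplicative (ZMod (2 ^ k)))

/-- The generator of the top group of `W_k`. -/
def xW (k : ℕ) : W k := ⟨1, Multiplicative.ofAdd 1⟩

/-- The generator of the factor of the base group of `W_k` at the identity. -/
def yW (k : ℕ) : W k := ⟨Pi.mulSingle 1 (Multiplicative.ofAdd 1), 1⟩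

/-- The base group `B_k ≅ C₂^(2^k)` of `W_k`. -/
def B (k : ℕ) : Subgroup (W k) := (RegularWreathProduct.rightHom : W k →* _).ker

instance (k : ℕ) : (B k).Normal := by unfold B; infer_instance

instance (k : ℕ) : Finite (W k) := by
  have : NeZero (2 ^ k) := ⟨by positivity⟩
  have : Finite (Multiplicative (ZMod 2)) := inferInstanceAs (Finite (ZMod 2))
  have : Finite (Multiplicative (ZMod (2 ^ k))) := inferInstanceAs (Finite (ZMod (2 ^ k)))
  infer_instance

lemma isPGroup_W (k : ℕ) : IsPGroup 2 (W k) := by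
  have : NeZero (2 ^ k) := ⟨by positivity⟩
  have : Finite (Multiplicative (ZMod (2 ^ k))) := inferInstanceAs (Finite (ZMod (2 ^ k)))
  apply IsPGroup.of_card (n := 2 ^ k + k)
  rw [RegularWreathProduct.card]
  have h2 : Nat.card (Multiplicative (ZMod 2)) = 2 := Nat.card_zmod 2
  have hk : Nat.card (Multiplicative (ZMod (2 ^ k))) = 2 ^ k := Nat.card_zmod (2 ^ k)
  rw [h2, hk, pow_add]

/-- The continuous homomorphism `F₂ → W_k` sending `a` to `xW k` and `b` to `yW k`. -/
def toW (k : ℕ) : F →* W k := lift (isPGroup_W k) (FreeGroup.lift ![xW k, yW k])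

lemma toW_a (k : ℕ) : toW k a = xW k := by
  rw [toW, a, lift_ι]; simp

lemma toW_b (k : ℕ) : toW k b = yW k := by
  rw [toW, b, lift_ι]; simp

/-! ## The groups `G_k` -/

/-- The subgroup `H ^ n` generated by the `n`-th powers of the elements of `H`. -/
def powSubgroup {Γ : Type*} [Group Γ] (H : Subgroup Γ) (n : ℕ) : Subgroup Γ :=
  Subgroup.closure ((fun h => h ^ n) '' (H : Set Γ))

instance powSubgroup_normal {Γ : Type*} [Group Γ] (H : Subgroup Γ) [hH : H.Normal] (n : ℕ) :
    (powSubgroup H n).Normal := by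
  have h : powSubgroup H n = Subgroup.normalClosure ((fun h => h ^ n) '' (H : Set Γ)) := by
    apply le_antisymm Subgroup.closure_le_normalClosure
    rw [Subgroup.normalClosure]
    apply Subgroup.closure_mono
    intro z hz
    obtain ⟨_, ⟨h, hh, rfl⟩, hc⟩ := Group.mem_conjugatesOfSet_iff.mp hz
    obtain ⟨c, rfl⟩ := isConj_iff.mp hc
    exact ⟨c * h * c⁻¹, hH.conj_mem h hh c, conj_pow⟩
  rw [h]
  infer_instance

/-- The closed normal subgroup `R_k` of `F₂`, with `F₂ ⧸ R_k ≅ W_k`. -/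
def R (k : ℕ) : Subgroup F := (toW k).ker

/-- The closed normal subgroup `Y_k` of `F₂`, the pre-image of the base group `B_k`. -/
def Y (k : ℕ) : Subgroup F := (B k).comap (toW k)

instance (k : ℕ) : (R k).Normal := by unfold R; infer_instance

instance (k : ℕ) : (Y k).Normal := by unfold Y; infer_instance

/-- The closed normal subgroup `N_k = [R_k, Y_k] R_k² ⟨a^(2^k)⟩^{F₂}` of `F₂`. -/
def N (k : ℕ) : Subgroup F :=
  (⁅R k, Y k⁆ ⊔ powSubgroup (R k) 2 ⊔ Subgroup.normalClosure {a ^ 2 ^ k}).topologicalClosure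

instance (k : ℕ) : (N k).Normal := by
  unfold N
  exact Subgroup.is_normal_topologicalClosure _

/-- `G_k = F₂ ⧸ N_k`. -/
abbrev G (k : ℕ) : Type := F ⧸ N k

/-- The image of `a` in `G_k`. -/
def x (k : ℕ) : G k := QuotientGroup.mk a

/-- The image of `b` in `G_k`. -/
def y (k : ℕ) : G k := QuotientGroup.mk b

/-! ## Commutators and series -/

/-- The commutator `[g, h] = g⁻¹ h⁻¹ g h`. -/
def comm {Γ : Type*} [Group Γ] (g h : Γ) : Γ := g⁻¹ * h⁻¹ * g * h

/-- The left-normed commutators `c 1 = y` and `c i = [y, x, …, x]` with `i - 1` occurrences of `x`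
in `G_k`; the value at `0` is not used. -/
def c (k : ℕ) : ℕ → G k
  | 0 => 1
  | 1 => y k
  | i + 2 => comm (c k (i + 1)) (x k)

/-- The lower central series `γ_1 = Γ`, `γ_{i+1} = [γ_i, Γ]`, indexed from `1`. -/
def γ (Γ : Type*) [Group Γ] (i : ℕ) : Subgroup Γ :=
  (⊤ : Subgroup Γ).lowerCentralSeries (i - 1)

/-- The lower `p`-series `P_1 = Γ`, `P_{i+1} = P_i ^ p [P_i, Γ]` of an abstract group `Γ`
(in a finite discrete group all subgroups are closed); in addition `P_0 = Γ`. -/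
def lowerPSeries (p : ℕ) (Γ : Type*) [Group Γ] : ℕ → Subgroup Γ
  | 0 => ⊤
  | 1 => ⊤
  | i + 2 => powSubgroup (lowerPSeries p Γ (i + 1)) p ⊔ ⁅lowerPSeries p Γ (i + 1), ⊤⁆

/-- The lower `p`-series of `Γ` reaches the trivial group, and has length `n`: the least `n`
with `P_{n+1} = 1`. -/
def LowerPSeriesHasLength (p : ℕ) (Γ : Type*) [Group Γ] (n : ℕ) : Prop :=
  IsLeast {n : ℕ | lowerPSeries p Γ (n + 1) = ⊥} n

end ProTwo

end

noncomputable section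

open scoped commutatorElement

namespace ProTwo

/-! ### Commutators, lower central series and lower `2`-series of an arbitrary group -/

section Series

variable {Γ : Type*} [Group Γ]

/-! The proof replaces `G k` by an explicit group. Let `D = ⟨τ⟩` be cyclic of order `q = 2 ^ k`.
Elements of `TensorExt D` are triples `(v, z, d)` with `v ∈ 𝔽₂[D]`, `z ∈ 𝔽₂[D × D]`, multiplied with
the bilinear cocycle `v ⊗ v'`. For `d = 1` squares have tensor part `v ⊗ v`, and commutators `v ⊗ v'
- v' ⊗ v`, so `a ↦ τ`, `b ↦ 1` kills `N k`. The resulting map `rep k` is faithful: in the group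
generated by the conjugates of `y`, squares and commutators of generators are central of exponent
`2`, and their images `e_i ⊗ e_i`, `e_i ⊗ e_j - e_j ⊗ e_i` are linearly independent
(`injective_of_central`). Density of the abstract free group in `F` does the rest
(`ker_proRep_le_N`).

Nilpotency class: let `s`, `t` be the two copies of `τ⁻¹ - 1` in `𝔽₂[D × D]`, `J = (s, t)` and `δ =
s + t + st`. Commutation with `x` multiplies `v` by `τ⁻¹ - 1`, and multiplies `z` by `δ` once `v =
0`. An element of `γ_{q+1}` has `v = 0` and a symmetric `z ∈ J^(q-1)`; such `z` are killed by
`δ^(q-1)`, so `γ_{2q} = 1` (`γ_eq_bot`). Conversely `[c_q, y, x, …, x]` with `q - 2` final entries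
`x` has tensor part `δ^(q-2) (s^(q-1) - t^(q-1)) ≠ 0` (`γ_ne_bot`).

Lower `2`-series: modulo `γ_{i+1}`, the only new square coming from `γ_i` is `c_i ^ 2`, and
commutation with `x` carries `c_i ^ 2` to `c_{i+1} ^ 2` modulo `γ_{i+2}`. This gives `P_{i+1} =
⟨x^(2^i), c_i ^ 2⟩ γ_{i+1}` for all `i ≥ 1` (`lowerPSeries_eq`). For `i > q/2` the square is
redundant (`sqSubgroup_eq_γ`), because `x^(q/2)` squares to `1` and hence inverts `[y, x^(q/2)]`,
which has the same square as `c_{q/2+1}`. -/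

lemma comm_eq_commutatorElement (g h : Γ) : comm g h = ⁅g⁻¹, h⁻¹⁆ := by
  simp [comm, commutatorElement_def]

lemma mul_comm_eq_conj (g h : Γ) : g * comm g h = h⁻¹ * g * h := by
  simp [comm, mul_assoc]

lemma commutator_le_of_comm_mem {H₁ H₂ K : Subgroup Γ}
    (h : ∀ g ∈ H₁, ∀ g' ∈ H₂, comm g g' ∈ K) : ⁅H₁, H₂⁆ ≤ K := by
  rw [Subgroup.commutator_le]
  intro g hg g' hg'
  simpa [comm_eq_commutatorElement] using h g⁻¹ (inv_mem hg) g'⁻¹ (inv_mem hg')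

lemma comm_mem_commutator {H₁ H₂ : Subgroup Γ} {g h : Γ} (hg : g ∈ H₁) (hh : h ∈ H₂) :
    comm g h ∈ ⁅H₁, H₂⁆ := by
  rw [comm_eq_commutatorElement]
  exact Subgroup.commutator_mem_commutator (inv_mem hg) (inv_mem hh)

lemma normal_of_comm_mem {K : Subgroup Γ} (h : ∀ g ∈ K, ∀ g', comm g g' ∈ K) : K.Normal := by
  refine ⟨fun n hn g => ?_⟩
  have := mul_mem hn (h n hn g⁻¹)
  rwa [mul_comm_eq_conj, inv_inv] at this

lemma comm_mem_iff_commute (K : Subgroup Γ) [K.Normal] (g h : Γ) :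
    comm g h ∈ K ↔ Commute (g : Γ ⧸ K) (h : Γ ⧸ K) := by
  rw [← QuotientGroup.eq_one_iff]
  simp only [comm, QuotientGroup.mk_mul, QuotientGroup.mk_inv]
  constructor
  · intro e
    have : ((g : Γ ⧸ K))⁻¹ * (h : Γ ⧸ K)⁻¹ * (g * h) = 1 := by simpa [mul_assoc] using e
    rw [← mul_inv_rev, inv_mul_eq_one] at this
    exact this.symm
  · intro e
    rw [mul_assoc, e.eq]; group

lemma comm_mem_of_mem {K : Subgroup Γ} [hK : K.Normal] {g : Γ} (hg : g ∈ K) (h : Γ) :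
    comm g h ∈ K := by
  have := mul_mem (inv_mem hg) (hK.conj_mem g hg h⁻¹)
  simpa [comm, mul_assoc] using this

/-- The elements that commute with `g` modulo `K`. -/
def centralizerMod (K : Subgroup Γ) [K.Normal] (g : Γ) : Subgroup Γ :=
  (Subgroup.centralizer {(g : Γ ⧸ K)}).comap (QuotientGroup.mk' K)

lemma mem_centralizerMod {K : Subgroup Γ} [K.Normal] {g h : Γ} :
    h ∈ centralizerMod K g ↔ comm g h ∈ K := by
  rw [comm_mem_iff_commute, centralizerMod, Subgroup.mem_comap, Subgroup.mem_centralizer_singleton_iff]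
  exact ⟨fun h => h.symm, fun h => h.symm⟩

/-- The elements that are central modulo `K`. -/
def centerMod (K : Subgroup Γ) [K.Normal] : Subgroup Γ :=
  (Subgroup.center (Γ ⧸ K)).comap (QuotientGroup.mk' K)

lemma mem_centerMod {K : Subgroup Γ} [K.Normal] {g : Γ} :
    g ∈ centerMod K ↔ ∀ h, comm g h ∈ K := by
  simp only [comm_mem_iff_commute, centerMod, Subgroup.mem_comap, Subgroup.mem_center_iff]
  constructor
  · intro h h'
    exact (h (h' : Γ ⧸ K)).symm
  · intro h h'
    obtain ⟨h', rfl⟩ := QuotientGroup.mk_surjective h'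
    exact (h h').symm

/-- The elements that are central and of order dividing `2` modulo `K`. -/
def omegaCenterMod (K : Subgroup Γ) [K.Normal] : Subgroup Γ where
  carrier := {g | g ^ 2 ∈ K ∧ g ∈ centerMod K}
  mul_mem' := by
    rintro g h ⟨hg, hg'⟩ ⟨hh, hh'⟩
    refine ⟨?_, mul_mem hg' hh'⟩
    have hc := (comm_mem_iff_commute K g h).1 (mem_centerMod.1 hg' h)
    rw [← QuotientGroup.eq_one_iff] at hg hh ⊢
    rw [QuotientGroup.mk_pow] at hg hh ⊢
    rw [QuotientGroup.mk_mul, hc.mul_pow, hg, hh, one_mul]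
  one_mem' := ⟨by simp, one_mem _⟩
  inv_mem' := by
    rintro g ⟨hg, hg'⟩
    exact ⟨by simpa using hg, inv_mem hg'⟩

lemma mem_omegaCenterMod {K : Subgroup Γ} [K.Normal] {g : Γ} :
    g ∈ omegaCenterMod K ↔ g ^ 2 ∈ K ∧ ∀ h, comm g h ∈ K := by
  rw [← mem_centerMod]; rfl

lemma omegaCenterMod_mono {K L : Subgroup Γ} [K.Normal] [L.Normal] (h : K ≤ L) :
    omegaCenterMod K ≤ omegaCenterMod L := by
  intro g hg
  rw [mem_omegaCenterMod] at hg ⊢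
  exact ⟨h hg.1, fun g' => h (hg.2 g')⟩

lemma lowerPSeries_succ (p : ℕ) {i : ℕ} (hi : 1 ≤ i) :
    lowerPSeries p Γ (i + 1) =
      powSubgroup (lowerPSeries p Γ i) p ⊔ ⁅lowerPSeries p Γ i, ⊤⁆ := by
  obtain ⟨i, rfl⟩ := Nat.exists_eq_add_of_le' hi
  rfl

/-- Source of all upper bounds on the series: it suffices that the previous term be central of
exponent `2` modulo `K`, and since `omegaCenterMod K` is a subgroup this can be tested on
generators. -/
lemma lowerPSeries_two_succ_le {i : ℕ} (hi : 1 ≤ i) {K : Subgroup Γ} [K.Normal]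
    (h : lowerPSeries 2 Γ i ≤ omegaCenterMod K) : lowerPSeries 2 Γ (i + 1) ≤ K := by
  rw [lowerPSeries_succ 2 hi]
  refine sup_le ?_ (commutator_le_of_comm_mem fun g hg g' _ =>
    (mem_omegaCenterMod.1 (h hg)).2 g')
  rw [powSubgroup, Subgroup.closure_le]
  rintro _ ⟨g, hg, rfl⟩
  exact (mem_omegaCenterMod.1 (h hg)).1

lemma sq_mem_lowerPSeries_succ {i : ℕ} (hi : 1 ≤ i) {g : Γ} (hg : g ∈ lowerPSeries 2 Γ i) :
    g ^ 2 ∈ lowerPSeries 2 Γ (i + 1) := by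
  rw [lowerPSeries_succ 2 hi]
  exact Subgroup.mem_sup_left (Subgroup.subset_closure ⟨g, hg, rfl⟩)

lemma γ_succ {i : ℕ} (hi : 1 ≤ i) : γ Γ (i + 1) = ⁅γ Γ i, ⊤⁆ := by
  obtain ⟨i, rfl⟩ := Nat.exists_eq_add_of_le' hi
  rfl

instance γ_normal (i : ℕ) : (γ Γ i).Normal := by
  unfold γ; infer_instance

lemma γ_antitone : Antitone (γ Γ) := fun _ _ h =>
  Subgroup.lowerCentralSeries_antitone _ (Nat.sub_le_sub_right h 1)

lemma comm_mem_γ_succ {i : ℕ} (hi : 1 ≤ i) {g : Γ} (hg : g ∈ γ Γ i) (h : Γ) :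
    comm g h ∈ γ Γ (i + 1) := by
  rw [γ_succ hi]
  exact comm_mem_commutator hg (Subgroup.mem_top h)

lemma γ_succ_le {i : ℕ} (hi : 1 ≤ i) {K : Subgroup Γ}
    (h : ∀ g ∈ γ Γ i, ∀ g', comm g g' ∈ K) : γ Γ (i + 1) ≤ K := by
  rw [γ_succ hi]
  exact commutator_le_of_comm_mem fun g hg g' _ => h g hg g'

lemma γ_le_lowerPSeries {i : ℕ} (hi : 1 ≤ i) : γ Γ i ≤ lowerPSeries 2 Γ i := by
  induction i, hi using Nat.le_induction with
  | base => exact le_top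
  | succ i hi ih =>
    rw [lowerPSeries_succ 2 hi, γ_succ hi]
    exact le_sup_of_le_right (Subgroup.commutator_mono ih le_rfl)

lemma normal_of_γ_le {i : ℕ} (hi : 1 ≤ i) {K : Subgroup Γ} (h₁ : γ Γ (i + 1) ≤ K)
    (h₂ : K ≤ γ Γ i) : K.Normal :=
  normal_of_comm_mem fun _ hg h => h₁ (comm_mem_γ_succ hi (h₂ hg) h)

/-- The left-normed commutators `[g, h, …, h]`: the value at `n + 1` has `n` occurrences of `h`. -/
def leftComm (g h : Γ) : ℕ → Γ
  | 0 => 1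
  | 1 => g
  | i + 2 => comm (leftComm g h (i + 1)) h

lemma leftComm_succ (g h : Γ) {i : ℕ} (hi : 1 ≤ i) :
    leftComm g h (i + 1) = comm (leftComm g h i) h := by
  obtain ⟨i, rfl⟩ := Nat.exists_eq_add_of_le' hi
  rfl

lemma leftComm_mem_γ {g : Γ} (h : Γ) {j : ℕ} (hj : 1 ≤ j) (hg : g ∈ γ Γ j) {i : ℕ} (hi : 1 ≤ i) :
    leftComm g h i ∈ γ Γ (j + i - 1) := by
  induction i, hi using Nat.le_induction with
  | base => exact hg
  | succ i hi ih =>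
    rw [leftComm_succ _ _ hi, show j + (i + 1) - 1 = (j + i - 1) + 1 by omega]
    exact comm_mem_γ_succ (by omega) ih h

end Series

/-! ### The lower `2`-series of a two-generator group with abelian quotient `Γ ⧸ H` -/

section TwoGenerated

variable {Γ : Type*} [Group Γ]

/-- `Γ = ⟨x, y⟩` has a normal subgroup `H` containing `y` with `Γ ⧸ H` abelian, and a normal
subgroup `Z` of exponent `2`, centralised by `H`, that contains the squares and the commutators of
the elements of `H`. -/
structure IsCyclicExtension (x y : Γ) (H Z : Subgroup Γ) : Prop where
  closure_eq_top : Subgroup.closure {x, y} = ⊤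
  normal : Z.Normal
  γ_two_le : γ Γ 2 ≤ H
  y_mem : y ∈ H
  sq_mem : ∀ h ∈ H, h ^ 2 ∈ Z
  comm_mem : ∀ h ∈ H, ∀ h' ∈ H, comm h h' ∈ Z
  comm_eq_one : ∀ z ∈ Z, ∀ h ∈ H, comm z h = 1
  sq_eq_one : ∀ z ∈ Z, z ^ 2 = 1

/-- The subgroup `⟨c_i ^ 2⟩ γ_{i+1}`, where `c_i = [y, x, …, x]`. -/
def sqSubgroup (x y : Γ) (i : ℕ) : Subgroup Γ :=
  Subgroup.closure {leftComm y x i ^ 2} ⊔ γ Γ (i + 1)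

variable {x y : Γ} {H Z : Subgroup Γ}

lemma leftComm_mem (x y : Γ) {i : ℕ} (hi : 1 ≤ i) : leftComm y x i ∈ γ Γ i := by
  simpa using leftComm_mem_γ x le_rfl (Subgroup.mem_top y) hi

lemma γ_le_sqSubgroup (x y : Γ) (i : ℕ) : γ Γ (i + 1) ≤ sqSubgroup x y i := le_sup_right

lemma sq_mem_sqSubgroup (x y : Γ) (i : ℕ) : leftComm y x i ^ 2 ∈ sqSubgroup x y i :=
  Subgroup.mem_sup_left (Subgroup.subset_closure rfl)

lemma sqSubgroup_le_γ (x y : Γ) {i : ℕ} (hi : 1 ≤ i) : sqSubgroup x y i ≤ γ Γ i := by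
  refine sup_le ?_ (γ_antitone (Nat.le_succ i))
  rw [Subgroup.closure_le, Set.singleton_subset_iff]
  exact pow_mem (leftComm_mem x y hi) 2

lemma sqSubgroup_normal (x y : Γ) {i : ℕ} (hi : 1 ≤ i) : (sqSubgroup x y i).Normal :=
  normal_of_γ_le hi (γ_le_sqSubgroup x y i) (sqSubgroup_le_γ x y hi)

namespace IsCyclicExtension

lemma forall_comm_mem (E : IsCyclicExtension x y H Z) {K : Subgroup Γ} [K.Normal] {g : Γ}
    (hx : comm g x ∈ K) (hy : comm g y ∈ K) (h : Γ) : comm g h ∈ K := by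
  have : (⊤ : Subgroup Γ) ≤ centralizerMod K g := by
    rw [← E.closure_eq_top, Subgroup.closure_le]
    rintro _ (rfl | rfl)
    · exact mem_centralizerMod.2 hx
    · exact mem_centralizerMod.2 hy
  exact mem_centralizerMod.1 (this (Subgroup.mem_top h))

lemma leftComm_mem_H (E : IsCyclicExtension x y H Z) {i : ℕ} (hi : 1 ≤ i) :
    leftComm y x i ∈ H := by
  obtain rfl | hi := hi.eq_or_lt
  · exact E.y_mem
  · exact E.γ_two_le (γ_antitone hi (leftComm_mem x y (by omega)))

/-- Two generators leave only `[y, x]` at the start. In the inductive step `[c_i, y]` lies in `Z`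
because both entries lie in `H`, and elements of `Z` commute with `y`; hence outside `Z` only `[c_i,
x] = c_{i+1}` is new. -/
lemma γ_le (E : IsCyclicExtension x y H Z) {i : ℕ} (hi : 2 ≤ i) :
    γ Γ i ≤ Subgroup.closure {leftComm y x i} ⊔ γ Γ (i + 1) ⊔ γ Γ i ⊓ Z := by
  have hZ := E.normal
  have hnormal : ∀ j, 1 ≤ j →
      (Subgroup.closure {leftComm y x j} ⊔ γ Γ (j + 1) ⊔ γ Γ j ⊓ Z).Normal := fun j hj =>
    normal_of_γ_le hj (le_sup_of_le_left le_sup_right) (by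
      refine sup_le (sup_le ?_ (γ_antitone (Nat.le_succ j))) inf_le_left
      rw [Subgroup.closure_le, Set.singleton_subset_iff]
      exact leftComm_mem x y hj)
  have hleft : ∀ j, leftComm y x j ∈
      Subgroup.closure {leftComm y x j} ⊔ γ Γ (j + 1) ⊔ γ Γ j ⊓ Z := fun j =>
    Subgroup.mem_sup_left (Subgroup.mem_sup_left (Subgroup.subset_closure rfl))
  induction i, hi using Nat.le_induction with
  | base =>
    have := hnormal 2 (by norm_num)
    set D := Subgroup.closure {leftComm y x 2} ⊔ γ Γ (2 + 1) ⊔ γ Γ 2 ⊓ Z with hD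
    have hyx : comm y x ∈ D := hleft 2
    have hxy : comm x y ∈ D := by
      have := inv_mem hyx
      simpa [comm, mul_assoc] using this
    have hx : x ∈ centerMod D := mem_centerMod.2 (E.forall_comm_mem (by simp [comm]) hxy)
    have hy : y ∈ centerMod D := mem_centerMod.2 (E.forall_comm_mem hyx (by simp [comm]))
    refine γ_succ_le le_rfl fun g _ g' => ?_
    have : (⊤ : Subgroup Γ) ≤ centerMod D := by
      rw [← E.closure_eq_top, Subgroup.closure_le]
      rintro _ (rfl | rfl) <;> assumption
    exact mem_centerMod.1 (this (Subgroup.mem_top g)) g'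
  | succ i hi ih =>
    have := hnormal (i + 1) (by omega)
    set D := Subgroup.closure {leftComm y x (i + 1)} ⊔ γ Γ (i + 1 + 1) ⊔ γ Γ (i + 1) ⊓ Z with hD
    have hDγ : γ Γ (i + 1 + 1) ≤ D := le_sup_of_le_left le_sup_right
    have hDZ : ∀ g, g ∈ γ Γ (i + 1) → g ∈ Z → g ∈ D := fun g h₁ h₂ =>
      Subgroup.mem_sup_right ⟨h₁, h₂⟩
    refine γ_succ_le (by omega) fun g hg g' => mem_centerMod.1 (SetLike.le_def.1 (ih.trans ?_) hg) g'
    refine sup_le (sup_le ?_ ?_) ?_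
    · rw [Subgroup.closure_le, Set.singleton_subset_iff]
      refine mem_centerMod.2 (E.forall_comm_mem ?_ ?_)
      · rw [← leftComm_succ _ _ (by omega)]
        exact hleft (i + 1)
      · exact hDZ _ (comm_mem_γ_succ (by omega) (leftComm_mem x y (by omega)) y)
          (E.comm_mem _ (E.leftComm_mem_H (by omega)) y E.y_mem)
    · exact fun g hg => mem_centerMod.2 fun h => hDγ (comm_mem_γ_succ (by omega) hg h)
    · rintro g ⟨hg, hgZ⟩
      refine mem_centerMod.2 (E.forall_comm_mem (hDZ _ (comm_mem_γ_succ (by omega) hg x) ?_) ?_)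
      · exact comm_mem_of_mem hgZ x
      · rw [E.comm_eq_one g hgZ y E.y_mem]
        exact one_mem _

/-- Centrality is automatic modulo `γ_{i+1}`, so squaring is tested on the generators given by
`γ_le`; those in `Z` square to `1`, and `c_i ^ 2` was put into the subgroup. -/
lemma γ_le_omegaCenterMod (E : IsCyclicExtension x y H Z) {i : ℕ} (hi : 2 ≤ i)
    [(sqSubgroup x y i).Normal] : γ Γ i ≤ omegaCenterMod (sqSubgroup x y i) := by
  have hc : ∀ g ∈ γ Γ i, g ^ 2 ∈ sqSubgroup x y i → g ∈ omegaCenterMod (sqSubgroup x y i) :=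
    fun g hg hg' => mem_omegaCenterMod.2 ⟨hg', fun h =>
      γ_le_sqSubgroup x y i (comm_mem_γ_succ (by omega) hg h)⟩
  refine (E.γ_le hi).trans (sup_le (sup_le ?_ ?_) ?_)
  · rw [Subgroup.closure_le, Set.singleton_subset_iff]
    exact hc _ (leftComm_mem x y (by omega)) (sq_mem_sqSubgroup x y i)
  · exact fun g hg => hc g (γ_antitone (Nat.le_succ i) hg) (γ_le_sqSubgroup x y i (pow_mem hg 2))
  · rintro g ⟨hg, hgZ⟩
    exact hc g hg (by rw [E.sq_eq_one g hgZ]; exact one_mem _)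

/-- Modulo `γ_{i+2}`, the commutator `[c_i ^ 2, x]` is `c_{i+1} ^ 2`. -/
lemma comm_sq_mul_inv_mem {i : ℕ} (hi : 1 ≤ i) :
    comm (leftComm y x i ^ 2) x * (leftComm y x (i + 1) ^ 2)⁻¹ ∈ γ Γ (i + 2) := by
  have hm : leftComm y x (i + 1) ∈ γ Γ (i + 1) := leftComm_mem x y (by omega)
  have hs := leftComm_succ y x hi
  set g := leftComm y x i
  set h := leftComm y x (i + 1)
  have h₁ : comm (g ^ 2) x = (g ^ 2)⁻¹ * (g * h) ^ 2 := by
    rw [hs]; simp [comm, pow_two, mul_assoc]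
  have h₂ : comm (g ^ 2) x * (h ^ 2)⁻¹ = (comm h⁻¹ g)⁻¹ := by
    rw [h₁]; simp [comm, pow_two, mul_assoc]
  rw [h₂]
  exact inv_mem (comm_mem_γ_succ (by omega) (inv_mem hm) g)

/-- The element `c_i ^ 2` lies in `Z`, so it commutes with `y`, while commuting it with `x` gives
`c_{i+1} ^ 2` modulo `γ_{i+2}`. -/
lemma comm_mem_sqSubgroup_succ (E : IsCyclicExtension x y H Z) {i : ℕ} (hi : 1 ≤ i) {g : Γ}
    (hg : g ∈ sqSubgroup x y i) (h : Γ) : comm g h ∈ sqSubgroup x y (i + 1) := by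
  have := sqSubgroup_normal x y (Nat.le_add_left 1 i)
  refine mem_centerMod.1 (SetLike.le_def.1 (?_ : sqSubgroup x y i ≤ _) hg) h
  refine sup_le ?_ fun g hg => mem_centerMod.2 fun h =>
    γ_le_sqSubgroup x y (i + 1) (comm_mem_γ_succ (by omega) hg h)
  rw [Subgroup.closure_le, Set.singleton_subset_iff]
  refine mem_centerMod.2 (E.forall_comm_mem ?_ ?_)
  · have := mul_mem (γ_le_sqSubgroup x y (i + 1) (comm_sq_mul_inv_mem (x := x) (y := y) hi))
      (sq_mem_sqSubgroup x y (i + 1))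
    rwa [inv_mul_cancel_right] at this
  · rw [E.comm_eq_one _ (E.sq_mem _ (E.leftComm_mem_H hi)) y E.y_mem]
    exact one_mem _

lemma sqSubgroup_le_omegaCenterMod (E : IsCyclicExtension x y H Z) {i : ℕ} (hi : 1 ≤ i)
    [(sqSubgroup x y (i + 1)).Normal] :
    sqSubgroup x y i ≤ omegaCenterMod (sqSubgroup x y (i + 1)) := by
  refine sup_le ?_ (E.γ_le_omegaCenterMod (by omega))
  rw [Subgroup.closure_le, Set.singleton_subset_iff]
  refine mem_omegaCenterMod.2 ⟨?_, E.comm_mem_sqSubgroup_succ hi (sq_mem_sqSubgroup x y i)⟩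
  rw [E.sq_eq_one _ (E.sq_mem _ (E.leftComm_mem_H hi))]
  exact one_mem _

/-- The identity `[y, g²] = [y, g]² [y, g, g]` with `g = x^(2^m)` raises the exponent, and both
factors move one term further down because each term is central of exponent `2` modulo the next. -/
lemma comm_pow_mem_sqSubgroup (E : IsCyclicExtension x y H Z) {m : ℕ} (hm : 1 ≤ m) :
    comm y (x ^ 2 ^ m) ∈ sqSubgroup x y (m + 1) := by
  have key : ∀ g : Γ, comm y (g ^ 2) = comm y g ^ 2 * comm (comm y g) g := fun g => by
    simp [comm, pow_two, mul_assoc]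
  induction m, hm using Nat.le_induction with
  | base =>
    rw [pow_one, key]
    refine mul_mem (sq_mem_sqSubgroup x y 2) (γ_le_sqSubgroup x y 2 ?_)
    exact comm_mem_γ_succ (by omega) (comm_mem_γ_succ le_rfl (Subgroup.mem_top y) x) x
  | succ m hm ih =>
    have := sqSubgroup_normal x y (show 1 ≤ m + 1 + 1 by omega)
    have h := mem_omegaCenterMod.1 (E.sqSubgroup_le_omegaCenterMod (by omega) ih)
    rw [pow_succ, pow_mul, key]
    exact mul_mem h.1 (h.2 _)

theorem lowerPSeries_eq (E : IsCyclicExtension x y H Z) {i : ℕ} (hi : 1 ≤ i) :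
    lowerPSeries 2 Γ (i + 1) = Subgroup.closure {x ^ 2 ^ i} ⊔ sqSubgroup x y i := by
  have hle : ∀ (i : ℕ) (K : Subgroup Γ), x ^ 2 ^ i ∈ K → sqSubgroup x y i ≤ K →
      Subgroup.closure {x ^ 2 ^ i} ⊔ sqSubgroup x y i ≤ K := fun i K h₁ h₂ =>
    sup_le (by rwa [Subgroup.closure_le, Set.singleton_subset_iff]) h₂
  have hx : ∀ i, x ^ 2 ^ i ∈ Subgroup.closure {x ^ 2 ^ i} ⊔ sqSubgroup x y i := fun i =>
    Subgroup.mem_sup_left (Subgroup.subset_closure rfl)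
  induction i, hi using Nat.le_induction with
  | base =>
    have hγ : γ Γ 2 ≤ sqSubgroup x y 1 := γ_le_sqSubgroup x y 1
    have : (Subgroup.closure {x ^ 2 ^ 1} ⊔ sqSubgroup x y 1).Normal :=
      normal_of_γ_le le_rfl (le_sup_of_le_right hγ) le_top
    refine le_antisymm (lowerPSeries_two_succ_le le_rfl ?_) (hle 1 _ ?_ (sup_le ?_ ?_))
    · change ⊤ ≤ _
      rw [← E.closure_eq_top, Subgroup.closure_le]
      rintro g hg
      refine mem_omegaCenterMod.2 ⟨?_, fun h => Subgroup.mem_sup_right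
        (hγ (comm_mem_γ_succ le_rfl (Subgroup.mem_top g) h))⟩
      obtain rfl | rfl := hg
      · exact hx 1
      · exact Subgroup.mem_sup_right (sq_mem_sqSubgroup x g 1)
    · exact sq_mem_lowerPSeries_succ le_rfl (Subgroup.mem_top x)
    · rw [Subgroup.closure_le, Set.singleton_subset_iff]
      exact sq_mem_lowerPSeries_succ le_rfl (Subgroup.mem_top y)
    · exact γ_le_lowerPSeries (by omega)
  | succ i hi ih =>
    have hS := sqSubgroup_normal x y (Nat.le_add_left 1 i)
    have hcx : comm (x ^ 2 ^ i) y ∈ sqSubgroup x y (i + 1) := by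
      have := inv_mem (E.comm_pow_mem_sqSubgroup hi)
      simpa [comm, mul_assoc] using this
    -- The bound for exponent `i + 1` is one term deeper than needed; it is weakened through
    -- `γ_{i+2}`.
    have hcx' : comm (x ^ 2 ^ (i + 1)) y ∈ sqSubgroup x y (i + 1) := by
      have := inv_mem (E.comm_pow_mem_sqSubgroup (Nat.le_add_left 1 i))
      exact γ_le_sqSubgroup x y (i + 1) (sqSubgroup_le_γ x y (by omega)
        (by simpa [comm, mul_assoc] using this))
    have hxx : ∀ n : ℕ, comm (x ^ n) x = 1 := fun n => by
      have : x ^ n * x = x * x ^ n := (pow_succ x n).symm.trans (pow_succ' x n)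
      rw [comm, mul_assoc, this]
      group
    have hN : (Subgroup.closure {x ^ 2 ^ (i + 1)} ⊔ sqSubgroup x y (i + 1)).Normal := by
      refine normal_of_comm_mem fun g hg h => Subgroup.mem_sup_right
        (mem_centerMod.1 (SetLike.le_def.1 (hle (i + 1) _ ?_ ?_) hg) h)
      · exact mem_centerMod.2 (E.forall_comm_mem (by rw [hxx]; exact one_mem _) hcx')
      · exact fun g hg => mem_centerMod.2 fun h => comm_mem_of_mem hg h
    refine le_antisymm (lowerPSeries_two_succ_le (by omega) ?_) (hle (i + 1) _ ?_ (sup_le ?_ ?_))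
    · rw [ih]
      refine hle i _ ?_ ((E.sqSubgroup_le_omegaCenterMod hi).trans (omegaCenterMod_mono le_sup_right))
      refine mem_omegaCenterMod.2 ⟨?_, E.forall_comm_mem ?_ (Subgroup.mem_sup_right hcx)⟩
      · rw [← pow_mul, ← pow_succ]
        exact hx (i + 1)
      · rw [hxx]
        exact one_mem _
    · rw [pow_succ, pow_mul]
      exact sq_mem_lowerPSeries_succ (by omega) (ih ▸ hx i)
    · rw [Subgroup.closure_le, Set.singleton_subset_iff]
      exact sq_mem_lowerPSeries_succ (by omega)
        (γ_le_lowerPSeries (by omega) (leftComm_mem x y (by omega)))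
    · exact γ_le_lowerPSeries (by omega)

end IsCyclicExtension

end TwoGenerated

/-! ### The group algebras of `D` and `D × D` over `𝔽₂` -/

section Algebra

variable (D : Type*) [CommGroup D]

/-- The group algebra of `D` over the field with two elements. -/
abbrev Alg : Type _ := MonoidAlgebra (ZMod 2) D

variable {D}

/-- The embedding `v ↦ v ⊗ 1` of `𝔽₂[D]` into `𝔽₂[D × D] = 𝔽₂[D] ⊗ 𝔽₂[D]`. -/
def inlAlg : Alg D →+* Alg (D × D) :=
  MonoidAlgebra.mapDomainRingHom (ZMod 2) (MonoidHom.inl D D)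

/-- The embedding `v ↦ 1 ⊗ v` of `𝔽₂[D]` into `𝔽₂[D × D] = 𝔽₂[D] ⊗ 𝔽₂[D]`. -/
def inrAlg : Alg D →+* Alg (D × D) :=
  MonoidAlgebra.mapDomainRingHom (ZMod 2) (MonoidHom.inr D D)

/-- The group element `d` as an element of `𝔽₂[D]`. -/
def el : D →* Alg D := MonoidAlgebra.of (ZMod 2) D

/-- The element `(d, d)` of `D × D` as an element of `𝔽₂[D × D]`. -/
def diagEl : D →* Alg (D × D) := el.comp ((MonoidHom.id D).prod (MonoidHom.id D))

instance : CharP (Alg D) 2 :=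
  charP_of_injective_ringHom
    (f := MonoidAlgebra.singleOneRingHom (R := ZMod 2) (M := D))
    (MonoidAlgebra.single_right_injective (R := ZMod 2) (m := (1 : D))) 2

instance [Finite D] : Finite (Alg D) :=
  have : Finite (D →₀ ZMod 2) := Finite.of_equiv (D → ZMod 2) Finsupp.equivFunOnFinite.symm
  Finite.of_equiv _ MonoidAlgebra.coeffEquiv.symm

lemma inlAlg_mul_inrAlg_el (d : D) : inlAlg (el d) * inrAlg (el d) = diagEl d := by
  simp [inlAlg, inrAlg, el, diagEl, MonoidAlgebra.single_mul_single]

lemma el_mul_coeff (d : D) (v : Alg D) (i : D) : (el d * v).coeff i = v.coeff (d⁻¹ * i) := by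
  simp [el, MonoidAlgebra.coeff_single_mul_apply]

lemma diagEl_mul_coeff (d : D) (z : Alg (D × D)) (i j : D) :
    (diagEl d * z).coeff (i, j) = z.coeff (d⁻¹ * i, d⁻¹ * j) := by
  simp [diagEl, el_mul_coeff]

lemma inlAlg_mul_inrAlg_coeff (v w : Alg D) (i j : D) :
    (inlAlg v * inrAlg w).coeff (i, j) = v.coeff i * w.coeff j := by
  classical
  induction v using MonoidAlgebra.induction_linear with
  | zero => simp
  | add v v' hv hv' => simp [add_mul, hv, hv']
  | single d c =>
    induction w using MonoidAlgebra.induction_linear with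
    | zero => simp
    | add w w' hw hw' => simp [mul_add, hw, hw']
    | single d' c' =>
      simp [inlAlg, inrAlg, MonoidAlgebra.single_mul_single, Finsupp.single_apply, ite_and]
      split_ifs <;> simp_all

end Algebra

/-! ### The model group -/

/-- The extension of `𝔽₂[D] ⋊ D` by `𝔽₂[D × D]` with cocycle `v ⊗ v'` on `𝔽₂[D]`. -/
@[ext]
structure TensorExt (D : Type*) [CommGroup D] where
  /-- The component in `𝔽₂[D]`. -/
  base : Alg D
  /-- The component in `𝔽₂[D × D]`. -/
  tens : Alg (D × D)
  /-- The component in `D`. -/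
  top : D

namespace TensorExt

variable {D : Type*} [CommGroup D]

instance : Mul (TensorExt D) where
  mul g h := ⟨g.base + el g.top * h.base,
    g.tens + diagEl g.top * h.tens + inlAlg g.base * inrAlg (el g.top * h.base), g.top * h.top⟩

instance : One (TensorExt D) where
  one := ⟨0, 0, 1⟩

instance : Inv (TensorExt D) where
  inv g := ⟨-(el g.top⁻¹ * g.base), diagEl g.top⁻¹ * (inlAlg g.base * inrAlg g.base - g.tens),
    g.top⁻¹⟩

@[simp] lemma mul_base (g h : TensorExt D) : (g * h).base = g.base + el g.top * h.base := rfl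

@[simp] lemma mul_tens (g h : TensorExt D) : (g * h).tens =
    g.tens + diagEl g.top * h.tens + inlAlg g.base * inrAlg (el g.top * h.base) := rfl

@[simp] lemma mul_top (g h : TensorExt D) : (g * h).top = g.top * h.top := rfl

@[simp] lemma one_base : (1 : TensorExt D).base = 0 := rfl

@[simp] lemma one_tens : (1 : TensorExt D).tens = 0 := rfl

@[simp] lemma one_top : (1 : TensorExt D).top = 1 := rfl

@[simp] lemma inv_base (g : TensorExt D) : g⁻¹.base = -(el g.top⁻¹ * g.base) := rfl

@[simp] lemma inv_tens (g : TensorExt D) :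
    g⁻¹.tens = diagEl g.top⁻¹ * (inlAlg g.base * inrAlg g.base - g.tens) := rfl

@[simp] lemma inv_top (g : TensorExt D) : g⁻¹.top = g.top⁻¹ := rfl

instance : Group (TensorExt D) where
  mul_assoc g h i := by
    ext1
    · simp only [mul_base, mul_top, map_mul]; ring
    · simp only [mul_base, mul_tens, mul_top, map_mul, map_add, ← inlAlg_mul_inrAlg_el]; ring
    · exact mul_assoc _ _ _
  one_mul g := by ext1 <;> simp
  mul_one g := by ext1 <;> simp
  inv_mul_cancel g := by
    ext1
    · simp
    · simp only [mul_tens, inv_tens, inv_base, inv_top, one_tens, ← inlAlg_mul_inrAlg_el, map_mul,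
        map_neg]
      ring
    · simp

/-- The projection onto the top group. -/
def topHom : TensorExt D →* D where
  toFun := top
  map_one' := rfl
  map_mul' _ _ := rfl

lemma topHom_apply (g : TensorExt D) : topHom g = g.top := rfl

/-- Two cases drive the later calculations: for `h.top = 1` the tensor part is `v ⊗ v' - v' ⊗ v`,
and for `g.base = 0` it is `g.tens` multiplied by `diagEl h.top⁻¹ - 1`. -/
lemma comm_eq {g : TensorExt D} (hg : g.top = 1) (h : TensorExt D) :
    comm g h = ⟨el h.top⁻¹ * g.base - g.base,
      diagEl h.top⁻¹ * (g.tens + inlAlg g.base * inrAlg h.base - inlAlg h.base * inrAlg g.base)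
        - g.tens + inlAlg g.base * inrAlg g.base - inlAlg g.base * inrAlg (el h.top⁻¹ * g.base),
      1⟩ := by
  have h₁ : comm g h = (h * g)⁻¹ * (g * h) := by simp [comm, mul_assoc]
  rw [h₁, inv_mul_eq_iff_eq_mul]
  have he : el h.top * el h.top⁻¹ = 1 := by rw [← map_mul, mul_inv_cancel, map_one]
  have hl : inlAlg (el h.top) * inlAlg (el h.top⁻¹) = 1 := by rw [← map_mul, he, map_one]
  have hr : inrAlg (el h.top) * inrAlg (el h.top⁻¹) = 1 := by rw [← map_mul, he, map_one]
  have hd : diagEl h.top * diagEl h.top⁻¹ = 1 := by rw [← map_mul, mul_inv_cancel, map_one]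
  ext1
  · simp only [mul_base, mul_top, hg, map_one, mul_one, one_mul]
    linear_combination (-g.base) * he
  · simp only [mul_base, mul_tens, mul_top, hg, map_one, mul_one, one_mul, map_add, map_mul,
      map_sub]
    generalize inlAlg h.base = a at *
    generalize inrAlg h.base = b at *
    generalize inlAlg g.base = c at *
    generalize inrAlg g.base = d at *
    rw [← inlAlg_mul_inrAlg_el h.top, ← inlAlg_mul_inrAlg_el h.top⁻¹]
    generalize inlAlg (el h.top) = p at *
    generalize inrAlg (el h.top) = q at *
    generalize inlAlg (el h.top⁻¹) = p' at *
    generalize inrAlg (el h.top⁻¹) = q' at *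
    linear_combination (g.tens + c * b - a * d) * (q * q') * (-hl) + (g.tens + c * b - a * d) * (-hr) - a * d * hr
  · simp [hg]

lemma sq_eq {g : TensorExt D} (hg : g.top = 1) :
    g ^ 2 = ⟨0, inlAlg g.base * inrAlg g.base, 1⟩ := by
  rw [pow_two]
  ext1
  · simp [hg, CharTwo.add_self_eq_zero]
  · simp [hg, CharTwo.add_self_eq_zero]
  · simp [hg]

lemma pow_four_eq_one {g : TensorExt D} (hg : g.top = 1) : g ^ 4 = 1 := by
  rw [show 4 = 2 * 2 from rfl, pow_mul, sq_eq hg, sq_eq rfl]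
  ext1 <;> simp

lemma isPGroup (hD : IsPGroup 2 D) : IsPGroup 2 (TensorExt D) := by
  intro g
  obtain ⟨n, hn⟩ := hD g.top
  refine ⟨n + 2, ?_⟩
  rw [pow_add, pow_mul]
  exact pow_four_eq_one (by rw [← topHom_apply, map_pow, topHom_apply, hn])

instance [Finite D] : Finite (TensorExt D) :=
  Finite.of_injective (fun g => (g.base, g.tens, g.top)) fun g h e => by
    simp only [Prod.mk.injEq] at e
    exact TensorExt.ext e.1 e.2.1 e.2.2

/-- The projection onto the wreath product `C₂ ≀ D`. -/
def toWreath : TensorExt D →* RegularWreathProduct (Multiplicative (ZMod 2)) D where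
  toFun g := ⟨fun d => Multiplicative.ofAdd (g.base.coeff d), g.top⟩
  map_one' := rfl
  map_mul' g h := by
    ext d
    · simp [el_mul_coeff]
    · rfl

lemma toWreath_eq_one_iff {g : TensorExt D} : toWreath g = 1 ↔ g.base = 0 ∧ g.top = 1 := by
  constructor
  · intro h
    refine ⟨?_, congrArg RegularWreathProduct.right h⟩
    ext d
    exact congrFun (congrArg RegularWreathProduct.left h) d
  · rintro ⟨h₁, h₂⟩
    refine RegularWreathProduct.ext (funext fun d => ?_) h₂
    change Multiplicative.ofAdd (g.base.coeff d) = 1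
    rw [h₁]
    rfl

/-- The elements `(v, z, d)` for which the off-diagonal part of `z` is symmetric up to the
off-diagonal part of `v ⊗ v`. -/
def symmSubgroup (D : Type*) [CommGroup D] : Subgroup (TensorExt D) where
  carrier := {g | ∀ i j, i ≠ j →
    g.tens.coeff (i, j) + g.tens.coeff (j, i) = g.base.coeff i * g.base.coeff j}
  mul_mem' := by
    intro g h hg hh i j hij
    have h₁ := hg i j hij
    have h₂ := hh (g.top⁻¹ * i) (g.top⁻¹ * j) (by simpa using hij)
    simp only [mul_tens, mul_base, MonoidAlgebra.coeff_add, Finsupp.add_apply, diagEl_mul_coeff,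
      inlAlg_mul_inrAlg_coeff, el_mul_coeff]
    linear_combination h₁ + h₂
  one_mem' := by intro i j _; simp
  inv_mem' := by
    intro g hg i j hij
    have h := hg (g.top * i) (g.top * j) (by simpa using hij)
    simp only [inv_tens, inv_base, MonoidAlgebra.coeff_sub, MonoidAlgebra.coeff_neg,
      Finsupp.neg_apply, Finsupp.sub_apply, diagEl_mul_coeff, inlAlg_mul_inrAlg_coeff, el_mul_coeff,
      inv_inv]
    linear_combination -h

lemma tens_symm {g : TensorExt D} (hg : g ∈ symmSubgroup D) (h : g.base = 0) (i j : D) :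
    g.tens.coeff (i, j) = g.tens.coeff (j, i) := by
  by_cases hij : i = j
  · rw [hij]
  · have := hg i j hij
    rw [h] at this
    exact CharTwo.add_eq_zero.1 (by simpa using this)

/-- The element acting by translation by `d`. -/
def ofTop (d : D) : TensorExt D := ⟨0, 0, d⟩

lemma ofTop_pow (d : D) (n : ℕ) : ofTop d ^ n = ofTop (d ^ n) := by
  induction n with
  | zero => simp only [pow_zero]; rfl
  | succ n ih =>
    rw [pow_succ, ih]
    ext1 <;> simp [ofTop, pow_succ]

/-- The element `1` of the group algebra. -/
def ofOne : TensorExt D := ⟨1, 0, 1⟩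

lemma ofTop_mem_symmSubgroup (d : D) : ofTop d ∈ symmSubgroup D := by
  intro i j _
  simp [ofTop]

lemma ofOne_mem_symmSubgroup : ofOne ∈ symmSubgroup D := by
  classical
  intro i j hij
  have : ¬ ((1 : D) = i ∧ (1 : D) = j) := fun h => hij (h.1.symm.trans h.2)
  simp only [ofOne, MonoidAlgebra.one_def, MonoidAlgebra.coeff_single, Finsupp.single_apply]
  split_ifs <;> simp_all

end TensorExt

/-! ### Two facts on commutative rings -/

section Ideal

lemma span_pair_pow_eq_bot {R : Type*} [CommRing R] {s t : R} {n : ℕ} (hs : s ^ (n + 1) = 0)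
    (ht : t ^ (n + 1) = 0) : Ideal.span {s, t} ^ (2 * n + 1) = ⊥ := by
  rw [Ideal.span_insert, ← Ideal.add_eq_sup, add_pow]
  refine Finset.sum_eq_zero fun m hm => ?_
  rw [Ideal.span_singleton_pow, Ideal.span_singleton_pow]
  obtain h | h : n + 1 ≤ m ∨ n + 1 ≤ 2 * n + 1 - m := by omega
  · rw [pow_eq_zero_of_le h hs]; simp
  · rw [pow_eq_zero_of_le h ht]; simp

-- By Frobenius, both sides multiplied by `a - 1` equal `a^(2^k) - 1`. Cancelling `a - 1` requires a
-- domain, so the identity is proved in `𝔽₂[X]` and specialised.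
open Polynomial in
lemma sub_one_pow_two_pow_sub_one {R : Type*} [CommRing R] [CharP R 2] (a : R) (k : ℕ) :
    (a - 1) ^ (2 ^ k - 1) = ∑ i ∈ Finset.range (2 ^ k), a ^ i := by
  have h : ((X : (ZMod 2)[X]) - 1) ^ (2 ^ k - 1) = ∑ i ∈ Finset.range (2 ^ k), X ^ i := by
    have h0 : (X : (ZMod 2)[X]) - 1 ≠ 0 := X_sub_C_ne_zero 1
    apply mul_right_cancel₀ h0
    rw [geom_sum_mul, ← pow_succ, Nat.sub_add_cancel Nat.one_le_two_pow, sub_pow_char_pow, one_pow]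
  have := congrArg (eval₂RingHom (ZMod.castHom dvd_rfl R) a) h
  simpa only [map_pow, map_sub, map_sum, map_one, coe_eval₂RingHom, eval₂_X] using this

end Ideal

/-! ### Augmentation ideals and the norm element -/

section GroupAlgebra

variable {D : Type*} [CommGroup D] {τ : D} {k : ℕ}

/-- The generator `τ⁻¹ - 1` of the augmentation ideal of `𝔽₂[D]`, where `D = ⟨τ⟩`. -/
def augEl (τ : D) : Alg D := el τ⁻¹ - 1

/-- The element `(τ⁻¹, τ⁻¹) - 1` of `𝔽₂[D × D]`. -/
def diagAug (τ : D) : Alg (D × D) := diagEl τ⁻¹ - 1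

/-- The augmentation ideal of `𝔽₂[D × D]`. -/
def augIdeal (τ : D) : Ideal (Alg (D × D)) := Ideal.span {inlAlg (augEl τ), inrAlg (augEl τ)}

lemma inlAlg_mem_augIdeal (τ : D) : inlAlg (augEl τ) ∈ augIdeal τ :=
  Ideal.subset_span (Set.mem_insert _ _)

lemma inrAlg_mem_augIdeal (τ : D) : inrAlg (augEl τ) ∈ augIdeal τ :=
  Ideal.subset_span (Set.mem_insert_of_mem _ rfl)

lemma diagAug_eq (τ : D) : diagAug τ =
    inlAlg (augEl τ) + inrAlg (augEl τ) + inlAlg (augEl τ) * inrAlg (augEl τ) := by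
  rw [diagAug, ← inlAlg_mul_inrAlg_el, augEl, map_sub, map_sub, map_one, map_one]
  ring

lemma diagAug_mem_augIdeal (τ : D) : diagAug τ ∈ augIdeal τ := by
  rw [diagAug_eq]
  exact add_mem (add_mem (inlAlg_mem_augIdeal τ) (inrAlg_mem_augIdeal τ))
    (Ideal.mul_mem_left _ _ (inrAlg_mem_augIdeal τ))

lemma augEl_pow_two_pow (τ : D) (m : ℕ) : augEl τ ^ 2 ^ m = el (τ ^ 2 ^ m)⁻¹ - 1 := by
  rw [augEl, sub_pow_char_pow, one_pow, ← map_pow, inv_pow]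

lemma diagAug_pow_two_pow (τ : D) (m : ℕ) : diagAug τ ^ 2 ^ m = diagEl (τ ^ 2 ^ m)⁻¹ - 1 := by
  rw [diagAug, sub_pow_char_pow, one_pow, ← map_pow, inv_pow]

lemma augEl_pow_eq_zero (hτ : τ ^ 2 ^ k = 1) : augEl τ ^ 2 ^ k = 0 := by
  rw [augEl_pow_two_pow, hτ, inv_one, map_one, sub_self]

lemma exists_pow_inv_eq (hgen : ∀ d : D, ∃ n : ℕ, d = τ ^ n) (d : D) : ∃ n : ℕ, d = τ⁻¹ ^ n := by
  obtain ⟨n, hn⟩ := hgen d⁻¹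
  exact ⟨n, by rw [inv_pow, ← hn, inv_inv]⟩

lemma augEl_dvd (hgen : ∀ d : D, ∃ n : ℕ, d = τ ^ n) (d : D) : augEl τ ∣ el d - 1 := by
  obtain ⟨n, rfl⟩ := exists_pow_inv_eq hgen d
  simpa only [augEl, map_pow, one_pow] using sub_dvd_pow_sub_pow (el τ⁻¹) 1 n

lemma diagAug_dvd (hgen : ∀ d : D, ∃ n : ℕ, d = τ ^ n) (d : D) : diagAug τ ∣ diagEl d - 1 := by
  obtain ⟨n, rfl⟩ := exists_pow_inv_eq hgen d
  simpa only [diagAug, map_pow, one_pow] using sub_dvd_pow_sub_pow (diagEl τ⁻¹) 1 n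

lemma augIdeal_pow_eq_bot (hτ : τ ^ 2 ^ k = 1) : augIdeal τ ^ (2 * (2 ^ k - 1) + 1) = ⊥ := by
  have h : 2 ^ k - 1 + 1 = 2 ^ k := Nat.sub_add_cancel Nat.one_le_two_pow
  apply span_pair_pow_eq_bot <;> rw [h, ← map_pow, augEl_pow_eq_zero hτ, map_zero]

lemma inlAlg_el_mul_coeff (d : D) (z : Alg (D × D)) (i j : D) :
    (inlAlg (el d) * z).coeff (i, j) = z.coeff (d⁻¹ * i, j) := by
  simp [inlAlg, el]

lemma inrAlg_el_mul_coeff (d : D) (z : Alg (D × D)) (i j : D) :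
    (inrAlg (el d) * z).coeff (i, j) = z.coeff (i, d⁻¹ * j) := by
  simp [inrAlg, el]

/-- Being killed by both copies of `τ⁻¹ - 1` means being invariant under all translations by `D ×
D`. -/
lemma coeff_eq_of_mul_augEl_eq_zero (hgen : ∀ d : D, ∃ n : ℕ, d = τ ^ n) {z : Alg (D × D)}
    (hl : inlAlg (augEl τ) * z = 0) (hr : inrAlg (augEl τ) * z = 0) (i j i' j' : D) :
    z.coeff (i, j) = z.coeff (i', j') := by
  have key : ∀ d, inlAlg (el d) * z = z ∧ inrAlg (el d) * z = z := by
    intro d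
    obtain ⟨c, hc⟩ := augEl_dvd hgen d
    have hd : el d = augEl τ * c + 1 := by rw [← hc]; ring
    simp only [hd, map_add, map_mul, map_one]
    constructor
    · linear_combination inlAlg c * hl
    · linear_combination inrAlg c * hr
  have h₁ := inlAlg_el_mul_coeff (i * i'⁻¹) z i j
  have h₂ := inrAlg_el_mul_coeff (j * j'⁻¹) z i' j
  rw [(key _).1] at h₁
  rw [(key _).2] at h₂
  rw [h₁, show (i * i'⁻¹)⁻¹ * i = i' by group, h₂, show (j * j'⁻¹)⁻¹ * j = j' by group]

lemma coeff_sum_range {z : Alg (D × D)} (n : ℕ) (i j : D) :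
    ((∑ m ∈ Finset.range n, diagEl τ⁻¹ ^ m) * z).coeff (i, j) =
      ∑ m ∈ Finset.range n, z.coeff (τ ^ m * i, τ ^ m * j) := by
  rw [Finset.sum_mul, MonoidAlgebra.coeff_sum, Finsupp.finsetSum_apply]
  refine Finset.sum_congr rfl fun m _ => ?_
  rw [← map_pow, diagEl_mul_coeff, inv_pow, inv_inv]

/-- A symmetric tensor in the augmentation ideal to the power `2 ^ k - 1` is annihilated by
the norm element. -/
lemma diagAug_pow_mul_eq_zero (hk : 1 ≤ k) (hτ : τ ^ 2 ^ k = 1)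
    (hgen : ∀ d : D, ∃ n : ℕ, d = τ ^ n) {z : Alg (D × D)}
    (hz : z ∈ augIdeal τ ^ (2 ^ k - 1)) (hsymm : ∀ i j, z.coeff (i, j) = z.coeff (j, i)) :
    diagAug τ ^ (2 ^ k - 1) * z = 0 := by
  have hw : diagAug τ ^ (2 ^ k - 1) * z ∈ augIdeal τ ^ (2 * (2 ^ k - 1)) := by
    rw [two_mul, pow_add]
    exact Ideal.mul_mem_mul (Ideal.pow_mem_pow (diagAug_mem_augIdeal τ) _) hz
  -- The product already lies in the last possibly nonzero power of the augmentation ideal, so all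
  -- its coefficients agree and a single one has to be computed.
  have hann : ∀ a ∈ augIdeal τ, a * (diagAug τ ^ (2 ^ k - 1) * z) = 0 := by
    intro a ha
    have := Ideal.mul_mem_mul ha hw
    rwa [← pow_succ', augIdeal_pow_eq_bot hτ, Ideal.mem_bot] at this
  -- Multiplication by the norm element sums `z` over the diagonal orbit of `(1, τ^(q/2))`, with `q
  -- = 2 ^ k`. The shift `m ↦ m + q/2` swaps the two coordinates there, so by symmetry the terms
  -- cancel in pairs.
  have hval : (diagAug τ ^ (2 ^ k - 1) * z).coeff (1, τ ^ 2 ^ (k - 1)) = 0 := by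
    have hq : 2 ^ k = 2 ^ (k - 1) + 2 ^ (k - 1) := by
      rw [← two_mul, ← pow_succ', Nat.sub_add_cancel hk]
    rw [diagAug, sub_one_pow_two_pow_sub_one, coeff_sum_range, hq, Finset.sum_range_add,
      ← Finset.sum_add_distrib]
    refine Finset.sum_eq_zero fun m _ => ?_
    rw [hsymm (τ ^ (2 ^ (k - 1) + m) * 1), pow_add τ _ m, mul_one, mul_one,
      mul_comm (τ ^ m) (τ ^ 2 ^ (k - 1)), mul_right_comm, ← pow_add τ (2 ^ (k - 1)) (2 ^ (k - 1)), ← hq, hτ,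
      one_mul]
    exact CharTwo.add_self_eq_zero _
  ext ⟨i, j⟩
  rw [coeff_eq_of_mul_augEl_eq_zero hgen (hann _ (inlAlg_mem_augIdeal τ))
    (hann _ (inrAlg_mem_augIdeal τ)) i j 1 (τ ^ 2 ^ (k - 1)), hval]
  rfl

/-- This power is the norm element `∑ τ⁻ⁱ`, whose coefficient at `1` is `1`. -/
lemma augEl_pow_ne_zero (hτ : orderOf τ = 2 ^ k) : augEl τ ^ (2 ^ k - 1) ≠ 0 := by
  classical
  intro h
  have h₁ : (augEl τ ^ (2 ^ k - 1)).coeff 1 = 1 := by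
    rw [augEl, sub_one_pow_two_pow_sub_one, MonoidAlgebra.coeff_sum, Finsupp.finsetSum_apply,
      Finset.sum_eq_single_of_mem 0 (by simp)]
    · simp
    · intro m hm hm0
      rw [← map_pow, el, MonoidAlgebra.of_apply, MonoidAlgebra.coeff_single,
        Finsupp.single_apply, if_neg]
      rw [inv_pow, inv_eq_one]
      intro h1
      have := orderOf_dvd_of_pow_eq_one h1
      rw [hτ] at this
      exact absurd (Nat.le_of_dvd (Nat.pos_of_ne_zero hm0) this) (by simpa using hm)
  rw [h] at h₁
  simp at h₁

/-- Multiplying by `s` removes `s^(q-1)` and leaves a multiple of `t^(q-1)`, against which `δ^(q-2)`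
counts only modulo `t`, that is as `s^(q-2)`. The result is `-s^(q-1) t^(q-1)`, which is nonzero as
a tensor product of nonzero elements. -/
lemma diagAug_pow_mul_ne_zero (hk : 1 ≤ k) (hτ : orderOf τ = 2 ^ k) :
    diagAug τ ^ (2 ^ k - 2) *
      (inlAlg (augEl τ) ^ (2 ^ k - 1) - inrAlg (augEl τ) ^ (2 ^ k - 1)) ≠ 0 := by
  have hq : 2 ≤ 2 ^ k := by
    calc 2 = 2 ^ 1 := rfl
      _ ≤ 2 ^ k := Nat.pow_le_pow_right (by norm_num) hk
  have hτ' : τ ^ 2 ^ k = 1 := by rw [← hτ]; exact pow_orderOf_eq_one τ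
  intro h
  obtain ⟨n, hn⟩ : ∃ n, 2 ^ k = n + 2 := ⟨2 ^ k - 2, by omega⟩
  have hs : inlAlg (augEl τ) ^ (n + 2) = 0 := by
    rw [← hn, ← map_pow, augEl_pow_eq_zero hτ', map_zero]
  have ht : inrAlg (augEl τ) ^ (n + 2) = 0 := by
    rw [← hn, ← map_pow, augEl_pow_eq_zero hτ', map_zero]
  have hst : inlAlg (augEl τ) ^ (n + 1) * inrAlg (augEl τ) ^ (n + 1) ≠ 0 := by
    have h0 := augEl_pow_ne_zero hτ
    rw [show 2 ^ k - 1 = n + 1 by omega] at h0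
    obtain ⟨i, hi⟩ : ∃ i, (augEl τ ^ (n + 1)).coeff i ≠ 0 := by
      by_contra! hc
      exact h0 (MonoidAlgebra.ext (Finsupp.ext hc))
    intro h
    rw [← map_pow, ← map_pow] at h
    have := inlAlg_mul_inrAlg_coeff (augEl τ ^ (n + 1)) (augEl τ ^ (n + 1)) i i
    rw [h] at this
    exact mul_ne_zero hi hi this.symm
  rw [show 2 ^ k - 1 = n + 1 by omega, show 2 ^ k - 2 = n by omega, diagAug_eq] at h
  generalize inlAlg (augEl τ) = s at *
  generalize inrAlg (augEl τ) = t at *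
  obtain ⟨c, hc⟩ : t ∣ (s + t + s * t) ^ n - s ^ n := by
    refine dvd_trans ?_ (sub_dvd_pow_sub_pow _ _ n)
    exact ⟨1 + s, by ring⟩
  refine hst ?_
  have hc' : (s + t + s * t) ^ n = t * c + s ^ n := by rw [← hc]; ring
  rw [hc'] at h
  linear_combination (-s) * h + (t * c + s ^ n) * hs - s * c * ht

end GroupAlgebra

/-! ### Class, squares and length of a faithfully represented group -/

section Representation

variable {D : Type*} [CommGroup D] {Γ : Type*} [Group Γ]

lemma map_comm (f : Γ →* TensorExt D) (g h : Γ) : f (comm g h) = comm (f g) (f h) := by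
  simp [comm]

/-- The group `Γ = ⟨x, y⟩` is faithfully represented by `x ↦ τ` and `y ↦ 1`, where `τ` is a
generator of `D` of order `2 ^ k`. -/
structure IsTensorRep (k : ℕ) (τ : D) (x y : Γ) (f : Γ →* TensorExt D) : Prop where
  one_le : 1 ≤ k
  orderOf_eq : orderOf τ = 2 ^ k
  exists_pow_eq : ∀ d : D, ∃ n : ℕ, d = τ ^ n
  closure_eq_top : Subgroup.closure {x, y} = ⊤
  map_x : f x = TensorExt.ofTop τ
  map_y : f y = TensorExt.ofOne
  injective : Function.Injective f

namespace IsTensorRep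

variable {k : ℕ} {τ : D} {x y : Γ} {f : Γ →* TensorExt D}

lemma pow_eq_one (S : IsTensorRep k τ x y f) : τ ^ 2 ^ k = 1 :=
  S.orderOf_eq ▸ pow_orderOf_eq_one τ

lemma top_eq_one_of_mem_γ {g : Γ} (f : Γ →* TensorExt D) {i : ℕ} (hi : 2 ≤ i) (hg : g ∈ γ Γ i) :
    (f g).top = 1 := by
  have : γ Γ 2 ≤ (TensorExt.topHom.comp f).ker := γ_succ_le le_rfl fun g _ h => by
    rw [MonoidHom.mem_ker, MonoidHom.comp_apply, map_comm]
    simp [comm, TensorExt.topHom_apply]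
  exact this (γ_antitone hi hg)

/-- The pre-image of the elements `(0, z, 1)`. -/
def tensSubgroup (f : Γ →* TensorExt D) : Subgroup Γ := (TensorExt.toWreath.comp f).ker

lemma mem_tensSubgroup {g : Γ} : g ∈ tensSubgroup f ↔ (f g).base = 0 ∧ (f g).top = 1 := by
  rw [tensSubgroup, MonoidHom.mem_ker, MonoidHom.comp_apply, TensorExt.toWreath_eq_one_iff]

lemma mem_ker_top {g : Γ} : g ∈ (TensorExt.topHom.comp f).ker ↔ (f g).top = 1 := Iff.rfl

lemma comm_eq_of_base_eq_zero {g : TensorExt D} (hb : g.base = 0) (ht : g.top = 1)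
    (h : TensorExt D) : comm g h = ⟨0, (diagEl h.top⁻¹ - 1) * g.tens, 1⟩ := by
  rw [TensorExt.comm_eq ht, hb]
  simp [sub_mul]

lemma isCyclicExtension (S : IsTensorRep k τ x y f) :
    IsCyclicExtension x y (TensorExt.topHom.comp f).ker (tensSubgroup f) where
  closure_eq_top := S.closure_eq_top
  normal := by unfold tensSubgroup; infer_instance
  γ_two_le := fun g hg => top_eq_one_of_mem_γ f le_rfl hg
  y_mem := by
    rw [mem_ker_top, S.map_y]; rfl
  sq_mem := by
    intro h hh
    rw [mem_tensSubgroup, map_pow, TensorExt.sq_eq (mem_ker_top.1 hh)]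
    exact ⟨rfl, rfl⟩
  comm_mem := by
    intro h hh h' hh'
    rw [mem_ker_top] at hh hh'
    rw [mem_tensSubgroup, map_comm, TensorExt.comm_eq hh, hh']
    simp
  comm_eq_one := by
    intro z hz h hh
    rw [mem_ker_top] at hh
    rw [mem_tensSubgroup] at hz
    apply S.injective
    rw [map_comm, comm_eq_of_base_eq_zero hz.1 hz.2, hh, map_one]
    ext1 <;> simp
  sq_eq_one := by
    intro z hz
    rw [mem_tensSubgroup] at hz
    apply S.injective
    rw [map_pow, TensorExt.sq_eq hz.2, hz.1, map_one]
    ext1 <;> simp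

/-- Both generators satisfy the symmetry condition. Through `tens_symm` this makes the tensor part
of every element with zero base symmetric, as the vanishing of `γ_{2q}` requires. -/
lemma mem_symmSubgroup (S : IsTensorRep k τ x y f) (g : Γ) : f g ∈ TensorExt.symmSubgroup D := by
  have : (⊤ : Subgroup Γ) ≤ (TensorExt.symmSubgroup D).comap f := by
    rw [← S.closure_eq_top, Subgroup.closure_le]
    rintro _ (rfl | rfl)
    · exact Subgroup.mem_comap.2 (S.map_x ▸ TensorExt.ofTop_mem_symmSubgroup τ)
    · exact Subgroup.mem_comap.2 (S.map_y ▸ TensorExt.ofOne_mem_symmSubgroup)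
  exact this (Subgroup.mem_top g)

/-- The elements `(v, z, 1)` with `v` in the ideal `J` and `z` in the ideal `K`. -/
def idealSubgroup (J : Ideal (Alg D)) (K : Ideal (Alg (D × D)))
    (h : ∀ v ∈ J, ∀ w ∈ J, inlAlg v * inrAlg w ∈ K) : Subgroup (TensorExt D) where
  carrier := {g | g.base ∈ J ∧ g.tens ∈ K ∧ g.top = 1}
  mul_mem' := by
    rintro g g' ⟨h₁, h₂, h₃⟩ ⟨h₁', h₂', h₃'⟩
    refine ⟨?_, ?_, by simp [h₃, h₃']⟩
    · exact add_mem h₁ (Ideal.mul_mem_left _ _ h₁')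
    · exact add_mem (add_mem h₂ (Ideal.mul_mem_left _ _ h₂')) (h _ h₁ _ (Ideal.mul_mem_left _ _ h₁'))
  one_mem' := ⟨zero_mem _, zero_mem _, rfl⟩
  inv_mem' := by
    rintro g ⟨h₁, h₂, h₃⟩
    exact ⟨neg_mem (Ideal.mul_mem_left _ _ h₁),
      Ideal.mul_mem_left _ _ (sub_mem (h _ h₁ _ h₁) h₂), by simp [h₃]⟩

lemma map_mem_span_pow {φ : Alg D →+* Alg (D × D)} (hφ : φ (augEl τ) ∈ augIdeal τ) {v : Alg D}
    {w : ℕ} (hv : v ∈ Ideal.span {augEl τ} ^ w) : φ v ∈ augIdeal τ ^ w := by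
  rw [Ideal.span_singleton_pow, Ideal.mem_span_singleton] at hv
  obtain ⟨c, rfl⟩ := hv
  rw [map_mul, map_pow]
  exact Ideal.mul_mem_right _ _ (Ideal.pow_mem_pow hφ w)

/-- The elements `(v, z, 1)` with `v` in the augmentation ideal to the power `w + 1` and `z` in the
augmentation ideal to the power `w`. -/
def augSubgroup (τ : D) (w : ℕ) : Subgroup (TensorExt D) :=
  idealSubgroup (Ideal.span {augEl τ} ^ (w + 1)) (augIdeal τ ^ w) fun _ hv _ _ =>
    Ideal.mul_mem_right _ _ (Ideal.pow_le_pow_right (Nat.le_succ w)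
      (map_mem_span_pow (inlAlg_mem_augIdeal τ) hv))

/-- The cross terms `v ⊗ v'` are only as deep in the augmentation filtration as `v`, whereas the new
base gains one degree; hence the tensor exponent stays one behind the base exponent. -/
lemma comm_mem_augSubgroup (S : IsTensorRep k τ x y f) {w : ℕ} {g : TensorExt D} (ht : g.top = 1)
    (hb : g.base ∈ Ideal.span {augEl τ} ^ w) (hc : g.tens ∈ augIdeal τ ^ (w - 1))
    (h : TensorExt D) : comm g h ∈ augSubgroup τ w := by
  have hl := map_mem_span_pow (inlAlg_mem_augIdeal τ) hb
  have hr := map_mem_span_pow (inrAlg_mem_augIdeal τ) hb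
  have hd : diagEl h.top⁻¹ * g.tens - g.tens ∈ augIdeal τ ^ w := by
    obtain ⟨c, hc'⟩ := diagAug_dvd S.exists_pow_eq h.top⁻¹
    rw [← sub_one_mul, hc']
    cases w with
    | zero => simp
    | succ w =>
      rw [pow_succ', mul_assoc]
      exact Ideal.mul_mem_mul (diagAug_mem_augIdeal τ) (Ideal.mul_mem_left _ _ hc)
  rw [TensorExt.comm_eq ht]
  refine ⟨?_, ?_, rfl⟩
  · obtain ⟨c, hc'⟩ := augEl_dvd S.exists_pow_eq h.top⁻¹
    change _ - _ ∈ _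
    rw [← sub_one_mul, hc', pow_succ', mul_assoc]
    exact Ideal.mul_mem_mul (Ideal.mem_span_singleton_self _) (Ideal.mul_mem_left _ _ hb)
  · change _ - _ + _ - _ ∈ _
    have : ∀ a b c p q r : Alg (D × D), p * (a + b - c) - a + q - r =
      (p * a - a) + p * (b - c) + (q - r) := by intros; ring
    rw [this]
    exact add_mem (add_mem hd (Ideal.mul_mem_left _ _ (sub_mem (Ideal.mul_mem_right _ _ hl)
      (Ideal.mul_mem_left _ _ hr)))) (sub_mem (Ideal.mul_mem_right _ _ hl)
        (Ideal.mul_mem_right _ _ hl))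

lemma γ_le_augSubgroup (S : IsTensorRep k τ x y f) {w : ℕ} :
    γ Γ (w + 2) ≤ (augSubgroup τ w).comap f := by
  induction w with
  | zero =>
    refine γ_succ_le le_rfl fun g _ h => ⟨?_, by simp,
      top_eq_one_of_mem_γ f le_rfl (comm_mem_γ_succ le_rfl (Subgroup.mem_top g) h)⟩
    have hel : ∀ d, Ideal.Quotient.mk (Ideal.span {augEl τ}) (el d) = 1 := fun d => by
      rw [← map_one (Ideal.Quotient.mk _), Ideal.Quotient.mk_eq_mk_iff_sub_mem,
        Ideal.mem_span_singleton]
      exact augEl_dvd S.exists_pow_eq d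
    rw [map_comm, zero_add, pow_one, ← Ideal.Quotient.eq_zero_iff_mem]
    simp [comm, hel]
  | succ w ih =>
    refine γ_succ_le (by omega) fun g hg h => ?_
    obtain ⟨h₁, h₂, h₃⟩ := ih hg
    rw [Subgroup.mem_comap, map_comm]
    exact S.comm_mem_augSubgroup h₃ h₁ h₂ _

/-- The nilpotency class of `Γ` is less than `2 ^ (k + 1)`. -/
theorem γ_eq_bot (S : IsTensorRep k τ x y f) : γ Γ (2 ^ (k + 1)) = ⊥ := by
  have hq : 1 ≤ 2 ^ k := Nat.one_le_two_pow
  -- From `γ_{q+1}` on the base is zero, and every commutator multiplies the tensor part by a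
  -- multiple of `δ`, so the power of `δ` needed to kill it drops by one at each step.
  have key : ∀ m ≤ 2 ^ k - 1, γ Γ (2 ^ k + 1 + m) ≤
      (idealSubgroup (⊥ : Ideal (Alg D)) (Submodule.torsionBy (Alg (D × D)) (Alg (D × D))
        (diagAug τ ^ (2 ^ k - 1 - m))) (by simp)).comap f := by
    intro m hm
    induction m with
    | zero =>
      intro g hg
      rw [show 2 ^ k + 1 + 0 = (2 ^ k - 1) + 2 by omega] at hg
      obtain ⟨h₁, h₂, h₃⟩ := S.γ_le_augSubgroup hg
      rw [Nat.sub_add_cancel hq, Ideal.span_singleton_pow, augEl_pow_eq_zero S.pow_eq_one,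
        Ideal.mem_span_singleton, zero_dvd_iff] at h₁
      refine ⟨by simpa using h₁, ?_, h₃⟩
      rw [Submodule.mem_torsionBy_iff]
      exact diagAug_pow_mul_eq_zero S.one_le S.pow_eq_one S.exists_pow_eq h₂
        (TensorExt.tens_symm (S.mem_symmSubgroup g) h₁)
    | succ m ih =>
      refine γ_succ_le (show 1 ≤ 2 ^ k + 1 + m by omega) fun g hg h => ?_
      obtain ⟨h₁, h₂, h₃⟩ := ih (by omega) hg
      rw [Subgroup.mem_comap, map_comm, comm_eq_of_base_eq_zero (by simpa using h₁) h₃]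
      refine ⟨zero_mem _, ?_, rfl⟩
      rw [Submodule.mem_torsionBy_iff, smul_eq_mul] at h₂ ⊢
      obtain ⟨c, hc⟩ := diagAug_dvd S.exists_pow_eq (f h).top⁻¹
      rw [show 2 ^ k - 1 - m = 2 ^ k - 1 - (m + 1) + 1 by omega, pow_succ] at h₂
      rw [hc]
      linear_combination c * h₂
  rw [eq_bot_iff]
  intro g hg
  rw [show 2 ^ (k + 1) = 2 ^ k + 1 + (2 ^ k - 1) by omega] at hg
  obtain ⟨h₁, h₂, h₃⟩ := key _ le_rfl hg
  rw [Submodule.mem_torsionBy_iff, Nat.sub_self, pow_zero, one_smul] at h₂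
  apply S.injective
  rw [map_one]
  exact TensorExt.ext (by simpa using h₁) h₂ h₃

lemma leftComm_top (S : IsTensorRep k τ x y f) {i : ℕ} (hi : 1 ≤ i) :
    (f (leftComm y x i)).top = 1 :=
  S.isCyclicExtension.leftComm_mem_H hi

lemma leftComm_base (S : IsTensorRep k τ x y f) (i : ℕ) :
    (f (leftComm y x (i + 1))).base = augEl τ ^ i := by
  induction i with
  | zero =>
    rw [pow_zero]
    exact congrArg TensorExt.base S.map_y
  | succ i ih =>
    rw [leftComm_succ _ _ (by omega), map_comm, TensorExt.comm_eq (S.leftComm_top (by omega)),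
      ih, S.map_x]
    change el τ⁻¹ * _ - _ = _
    rw [pow_succ', augEl]
    ring

lemma map_leftComm_eq (S : IsTensorRep k τ x y f) {g : Γ} (hb : (f g).base = 0)
    (ht : (f g).top = 1) (n : ℕ) :
    f (leftComm g x (n + 1)) = ⟨0, diagAug τ ^ n * (f g).tens, 1⟩ := by
  induction n with
  | zero =>
    rw [pow_zero, one_mul]
    exact TensorExt.ext hb rfl ht
  | succ n ih =>
    rw [leftComm_succ _ _ (by omega), map_comm, ih, comm_eq_of_base_eq_zero rfl rfl, S.map_x,
      pow_succ', mul_assoc]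
    rfl

/-- The nilpotency class of `Γ` is at least `2 ^ (k + 1) - 1`. -/
theorem γ_ne_bot (S : IsTensorRep k τ x y f) : γ Γ (2 ^ (k + 1) - 1) ≠ ⊥ := by
  have hq : 2 ≤ 2 ^ k := Nat.le_self_pow (by have := S.one_le; omega) 2
  have h₁ : leftComm y x (2 ^ k) ∈ γ Γ (2 ^ k) := leftComm_mem x y (by omega)
  have hbase := S.leftComm_base (2 ^ k - 1)
  rw [Nat.sub_add_cancel (by omega)] at hbase
  have htop := S.leftComm_top (i := 2 ^ k) (by omega)
  set g := leftComm y x (2 ^ k) with hg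
  -- Commuting with `y` rather than `x` at this point produces a nonzero tensor part `s^(q-1) -
  -- t^(q-1)` over the zero base.
  have h₂ : comm g y ∈ γ Γ (2 ^ k + 1) := comm_mem_γ_succ (by omega) h₁ y
  have hmap : f (comm g y) =
      ⟨0, inlAlg (augEl τ) ^ (2 ^ k - 1) - inrAlg (augEl τ) ^ (2 ^ k - 1), 1⟩ := by
    rw [map_comm, TensorExt.comm_eq htop, S.map_y, hbase]
    ext1
    · simp [TensorExt.ofOne]
    · simp only [TensorExt.ofOne, inv_one, map_one, map_pow, one_mul, mul_one]
      ring
    · rfl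
  have h₃ := leftComm_mem_γ x (by omega) h₂ (show 1 ≤ 2 ^ k - 2 + 1 by omega)
  have h₄ := S.map_leftComm_eq (g := comm g y) (by rw [hmap]) (by rw [hmap]) (2 ^ k - 2)
  intro hbot
  rw [show 2 ^ k + 1 + (2 ^ k - 2 + 1) - 1 = 2 ^ (k + 1) - 1 by omega, hbot, Subgroup.mem_bot] at h₃
  rw [h₃, map_one, hmap] at h₄
  exact diagAug_pow_mul_ne_zero S.one_le S.orderOf_eq (congrArg TensorExt.tens h₄).symm

lemma x_pow_eq_one (S : IsTensorRep k τ x y f) : x ^ 2 ^ k = 1 := by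
  apply S.injective
  rw [map_pow, S.map_x, TensorExt.ofTop_pow, S.pow_eq_one, map_one]
  rfl

/-- By Frobenius, commuting once with `x^(2^m)` multiplies the tensor part by `δ^(2^m)`, exactly as
`2^m` commutations with `x` do. -/
lemma comm_pow_mem_γ (S : IsTensorRep k τ x y f) {z : Γ} (hz : z ∈ tensSubgroup f) {i : ℕ}
    (hi : 1 ≤ i) (hzi : z ∈ γ Γ i) (m : ℕ) : comm z (x ^ 2 ^ m) ∈ γ Γ (i + 2 ^ m) := by
  obtain ⟨hb, ht⟩ := mem_tensSubgroup.1 hz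
  have h := leftComm_mem_γ x hi hzi (Nat.le_add_left 1 (2 ^ m))
  rw [← add_assoc, Nat.add_sub_cancel] at h
  convert h using 1
  apply S.injective
  rw [S.map_leftComm_eq hb ht, map_comm, comm_eq_of_base_eq_zero hb ht, diagAug_pow_two_pow,
    ← TensorExt.topHom_apply, map_pow, map_pow, S.map_x]
  rfl

/-- With `r = 2 ^ (k - 1)`, the square of `c_{r+1} = [y, x, …, x]` lies in `γ_{r+2}`. -/
lemma sq_leftComm_mem_γ (S : IsTensorRep k τ x y f) :
    leftComm y x (2 ^ (k - 1) + 1) ^ 2 ∈ γ Γ (2 ^ (k - 1) + 2) := by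
  have E := S.isCyclicExtension
  have hr : 1 ≤ 2 ^ (k - 1) := Nat.one_le_two_pow
  have hq : 2 ^ k = 2 ^ (k - 1) + 2 ^ (k - 1) := by
    rw [← two_mul, ← pow_succ', Nat.sub_add_cancel S.one_le]
  have hx := S.x_pow_eq_one
  have hcγ : leftComm y x (2 ^ (k - 1) + 1) ∈ γ Γ (2 ^ (k - 1) + 1) := leftComm_mem x y (by omega)
  have hcb := S.leftComm_base (2 ^ (k - 1))
  have hct := S.leftComm_top (i := 2 ^ (k - 1) + 1) (by omega)
  set c := leftComm y x (2 ^ (k - 1) + 1)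
  have hfe : (f (comm y (x ^ 2 ^ (k - 1)))).base = augEl τ ^ 2 ^ (k - 1) := by
    rw [map_comm, TensorExt.comm_eq (by rw [S.map_y]; rfl), augEl_pow_two_pow]
    have : (f (x ^ 2 ^ (k - 1))).top = τ ^ 2 ^ (k - 1) := by
      rw [← TensorExt.topHom_apply, map_pow, map_pow, S.map_x]; rfl
    rw [this, S.map_y]
    simp [TensorExt.ofOne]
  have heγ : comm y (x ^ 2 ^ (k - 1)) ∈ γ Γ 2 :=
    comm_mem_γ_succ le_rfl (Subgroup.mem_top y) _
  have het := top_eq_one_of_mem_γ f le_rfl heγ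
  -- Since `X = x^(2^(k-1))` satisfies `X² = 1`, conjugation by `X` inverts `[y, X]`.
  have hinv : comm (comm y (x ^ 2 ^ (k - 1))) (x ^ 2 ^ (k - 1)) =
      (comm y (x ^ 2 ^ (k - 1)) ^ 2)⁻¹ := by
    have hX : x ^ 2 ^ (k - 1) * x ^ 2 ^ (k - 1) = 1 := by rw [← pow_add, ← hq, hx]
    have hX' : (x ^ 2 ^ (k - 1))⁻¹ = x ^ 2 ^ (k - 1) := inv_eq_of_mul_eq_one_left hX
    simp only [comm, hX', mul_inv_rev, inv_inv, pow_two, mul_assoc]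
    simp only [hX, mul_one]
  set e := comm y (x ^ 2 ^ (k - 1))
  -- Squares depend only on the base, and `c` and `e` have the same base because `(τ⁻¹ -
  -- 1)^(2^(k-1)) = τ^(-2^(k-1)) - 1`.
  have hsq : c ^ 2 = e ^ 2 := by
    apply S.injective
    rw [map_pow, map_pow, TensorExt.sq_eq hct, TensorExt.sq_eq het, hcb, hfe]
  have hz : c⁻¹ * e ∈ tensSubgroup f := by
    rw [mem_tensSubgroup, map_mul, map_inv]
    simp [hct, het, hcb, hfe]
  have hzγ : c⁻¹ * e ∈ γ Γ 2 := mul_mem (inv_mem (γ_antitone (by omega) hcγ)) heγ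
  have h₁ := S.comm_pow_mem_γ hz (by omega) hzγ (k - 1)
  have h₂ : comm c (x ^ 2 ^ (k - 1)) ∈ γ Γ (2 ^ (k - 1) + 2) := comm_mem_γ_succ (by omega) hcγ _
  rw [hsq, ← inv_mem_iff, ← hinv]
  -- Writing `e = c (c⁻¹ e)` splits `[e, X]`: the first factor is deep because `c` is, the second
  -- because `c⁻¹ e ∈ γ_2` has zero base and `comm_pow_mem_γ` applies.
  have hce : comm e (x ^ 2 ^ (k - 1)) = (c⁻¹ * e)⁻¹ * comm c (x ^ 2 ^ (k - 1)) * (c⁻¹ * e) *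
      comm (c⁻¹ * e) (x ^ 2 ^ (k - 1)) := by
    simp [comm, mul_assoc]
  rw [hce]
  refine mul_mem ?_ (by rwa [add_comm] at h₁)
  simpa using (γ_normal (Γ := Γ) (2 ^ (k - 1) + 2)).conj_mem _ h₂ (c⁻¹ * e)⁻¹

/-- Once `c_i ^ 2 ∈ γ_{i+1}` for one `i`, commutation with `x` passes this on to all larger `i`. -/
theorem sqSubgroup_eq_γ (S : IsTensorRep k τ x y f) {i : ℕ} (hi : 2 ^ (k - 1) + 1 ≤ i) :
    sqSubgroup x y i = γ Γ (i + 1) := by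
  refine le_antisymm (sup_le ?_ le_rfl) (γ_le_sqSubgroup x y i)
  rw [Subgroup.closure_le, Set.singleton_subset_iff]
  induction i, hi using Nat.le_induction with
  | base => exact S.sq_leftComm_mem_γ
  | succ i hi ih =>
    have h := mul_mem (inv_mem (IsCyclicExtension.comm_sq_mul_inv_mem (x := x) (y := y) (i := i)
      ((Nat.le_add_left 1 _).trans hi)))
      (comm_mem_γ_succ (Nat.le_add_left 1 i) ih x)
    simpa using h

theorem lowerPSeriesHasLength (S : IsTensorRep k τ x y f) :
    LowerPSeriesHasLength 2 Γ (2 ^ (k + 1) - 1) := by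
  have hq : 2 ^ (k + 1) = 2 ^ (k - 1) + 2 ^ (k - 1) + 2 ^ k := by
    rw [← two_mul, ← pow_succ', Nat.sub_add_cancel S.one_le, pow_succ, mul_two]
  have hq' : 2 ^ k = 2 ^ (k - 1) + 2 ^ (k - 1) := by
    rw [← two_mul, ← pow_succ', Nat.sub_add_cancel S.one_le]
  have hr : 1 ≤ 2 ^ (k - 1) := Nat.one_le_two_pow
  constructor
  · change lowerPSeries 2 Γ (2 ^ (k + 1) - 1 + 1) = ⊥
    rw [S.isCyclicExtension.lowerPSeries_eq (by omega), S.sqSubgroup_eq_γ (by omega),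
      Nat.sub_add_cancel (by omega), S.γ_eq_bot, sup_bot_eq, Subgroup.closure_eq_bot_iff,
      Set.singleton_subset_iff, Set.mem_singleton_iff]
    have hk : k ≤ 2 ^ (k + 1) - 1 := by
      have := Nat.lt_two_pow_self (n := k)
      omega
    rw [← Nat.add_sub_cancel' hk, pow_add, pow_mul, S.x_pow_eq_one, one_pow]
  · intro n hn
    by_contra! hlt
    have h₁ : γ Γ (2 ^ (k + 1) - 1) ≤ lowerPSeries 2 Γ (n + 1) :=
      (γ_antitone (by omega)).trans (γ_le_lowerPSeries (by omega))
    exact S.γ_ne_bot (eq_bot_iff.2 (h₁.trans hn.le))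

end IsTensorRep

end Representation

/-! ### Injectivity from linear independence -/

section Independence

lemma linearIndependent_of_coeff {ι X : Type*} [DecidableEq ι] (w : ι → MonoidAlgebra (ZMod 2) X)
    (e : ι → X) (h : ∀ i j, (w j).coeff (e i) = if i = j then 1 else 0) :
    LinearIndependent (ZMod 2) w := by
  rw [linearIndependent_iff']
  intro s c hc i hi
  have := congrArg (fun v => MonoidAlgebra.coeff v (e i)) hc
  simpa [MonoidAlgebra.coeff_sum, Finsupp.finsetSum_apply, h, hi] using this

/-- A homomorphism from an abelian group generated by involutions to an `𝔽₂`-vector space is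
injective if the images of the generators are linearly independent. -/
lemma injective_of_linearIndependent {A M ι : Type*} [Group A] [AddCommGroup M]
    [Module (ZMod 2) M] {a : ι → A} (hcomm : ∀ i j, Commute (a i) (a j)) (hsq : ∀ i, a i ^ 2 = 1)
    (f : Subgroup.closure (Set.range a) →* Multiplicative M)
    (hf : LinearIndependent (ZMod 2) fun i =>
      Multiplicative.toAdd (f ⟨a i, Subgroup.subset_closure (Set.mem_range_self i)⟩)) :
    Function.Injective f := by
  let _ : CommGroup (Subgroup.closure (Set.range a)) :=
    { (inferInstance : Group (Subgroup.closure (Set.range a))) with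
      mul_comm := (Subgroup.isMulCommutative_closure (k := Set.range a) (by
        rintro _ ⟨i, rfl⟩ _ ⟨j, rfl⟩; exact (hcomm i j).eq)).is_comm.comm }
  let a' : ι → Subgroup.closure (Set.range a) := fun i =>
    ⟨a i, Subgroup.subset_closure (Set.mem_range_self i)⟩
  have htop : Subgroup.closure (Set.range a') = ⊤ := by
    rw [← Subgroup.closure_closure_coe_preimage (k := Set.range a)]
    congr 1
    ext ⟨g, hg⟩
    simp [a', Subtype.ext_iff]
  rw [injective_iff_map_eq_one]
  intro g hg
  obtain ⟨c, rfl⟩ := Subgroup.exists_finsupp_of_mem_closure_range a' g (htop ▸ Subgroup.mem_top g)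
  rw [linearIndependent_iff'] at hf
  have hsum : ∑ i ∈ c.support, (c i : ZMod 2) • Multiplicative.toAdd (f (a' i)) = 0 := by
    rw [Finsupp.prod, map_prod] at hg
    have := congrArg Multiplicative.toAdd hg
    simpa [toAdd_prod, Int.cast_smul_eq_zsmul] using this
  refine Finset.prod_eq_one fun i hi => ?_
  obtain ⟨n, hn⟩ := (ZMod.intCast_zmod_eq_zero_iff_dvd _ _).1 (hf _ _ hsum i hi)
  have : a' i ^ 2 = 1 := Subtype.ext (hsq i)
  change a' i ^ c i = 1
  rw [hn, zpow_mul]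
  norm_cast
  rw [this, one_zpow]

end Independence

/-! ### Faithfulness of homomorphisms to the model group -/

section Recognition

variable {D : Type*} [CommGroup D]

/-- The generators of the central subgroup generated by the squares and commutators of the `a d`. -/
def centralGen {H : Type*} [Group H] [DecidableEq D] (a : D → H) (p : D × D) : H :=
  if p.1 = p.2 then a p.1 ^ 2 else comm (a p.1) (a p.2)

lemma map_centralGen {H : Type*} [Group H] [DecidableEq D] {a : D → H} {φ : H →* TensorExt D}
    (hφ : ∀ d, φ (a d) = ⟨el d, 0, 1⟩) (p : D × D) :
    φ (centralGen a p) =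
      ⟨0, if p.1 = p.2 then el p else el p - el p.swap, 1⟩ := by
  have hel : ∀ i j : D, inlAlg (el i) * inrAlg (el j) = el (i, j) := fun i j => by
    simp [inlAlg, inrAlg, el, MonoidAlgebra.single_mul_single]
  obtain ⟨i, j⟩ := p
  by_cases h : i = j
  · subst h
    simp only [centralGen, if_true, map_pow, hφ]
    rw [TensorExt.sq_eq rfl, hel]
  · simp only [centralGen, h, if_false, map_comm, hφ]
    rw [TensorExt.comm_eq rfl]
    ext1
    · simp
    · simp only [inv_one, map_one, one_mul, hel, Prod.swap_prod_mk]
      ring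
    · rfl

/-- The relations make `H` an elementary abelian group extended by a central elementary abelian
group `Z`. On each layer the images of the natural generators are linearly independent, so `φ` is
injective on `Z` and on `H ⧸ Z`. -/
lemma injective_of_central {H : Type*} [Group H] {a : D → H}
    (htop : Subgroup.closure (Set.range a) = ⊤)
    (hsq : ∀ d, a d ^ 2 ∈ Subgroup.center H) (hsq' : ∀ d, (a d ^ 2) ^ 2 = 1)
    (hcomm : ∀ d d', comm (a d) (a d') ∈ Subgroup.center H)
    (hcomm' : ∀ d d', comm (a d) (a d') ^ 2 = 1)
    {φ : H →* TensorExt D} (hφ : ∀ d, φ (a d) = ⟨el d, 0, 1⟩) : Function.Injective φ := by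
  classical
  -- An arbitrary order, used to pick one of `(i, j)` and `(j, i)`: in characteristic `2` the two
  -- commutators have equal images, so keeping both would destroy independence.
  let _ : LinearOrder D := IsWellOrder.linearOrder WellOrderingRel
  have htriv : ∀ h, (φ h).top = 1 := by
    have : (⊤ : Subgroup H) ≤ (TensorExt.topHom.comp φ).ker := by
      rw [← htop, Subgroup.closure_le]
      rintro _ ⟨d, rfl⟩
      exact congrArg TensorExt.top (hφ d)
    exact fun h => this (Subgroup.mem_top h)
  let b : {p : D × D // p.1 ≤ p.2} → H := fun p => centralGen a p.1
  have hb : ∀ p, b p ∈ Subgroup.center H ∧ b p ^ 2 = 1 := fun p => by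
    by_cases h : p.1.1 = p.1.2 <;> simp only [b, centralGen, h, if_true, if_false]
    · exact ⟨hsq _, hsq' _⟩
    · exact ⟨hcomm _ _, hcomm' _ _⟩
  let Z := Subgroup.closure (Set.range b)
  have hZ : Z ≤ Subgroup.center H := by
    rw [Subgroup.closure_le]
    rintro _ ⟨p, rfl⟩
    exact (hb p).1
  have hZn : Z.Normal := ⟨fun z hz g => by
    rw [Subgroup.mem_center_iff.1 (hZ hz) g, mul_inv_cancel_right]
    exact hz⟩
  have hZφ : ∀ z ∈ Z, (φ z).base = 0 := by
    have : Z ≤ IsTensorRep.tensSubgroup φ := by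
      rw [Subgroup.closure_le]
      rintro _ ⟨p, rfl⟩
      refine IsTensorRep.mem_tensSubgroup.2 ?_
      simp only [b, map_centralGen hφ, and_self]
    exact fun z hz => (IsTensorRep.mem_tensSubgroup.1 (this hz)).1
  -- the restriction of `φ` to the central subgroup is injective
  let f₁ : Z →* Multiplicative (Alg (D × D)) :=
    { toFun := fun z => Multiplicative.ofAdd (φ z).tens
      map_one' := by simp
      map_mul' := fun z z' => by
        rw [Subgroup.coe_mul, map_mul, TensorExt.mul_tens, hZφ z z.2, htriv]
        simp }
  have hf₁ : Function.Injective f₁ := by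
    refine injective_of_linearIndependent
      (fun i j => (Subgroup.mem_center_iff.1 (hb i).1 (b j)).symm) (fun i => (hb i).2) f₁
      (linearIndependent_of_coeff _ (fun p => p.1) fun i j => ?_)
    change (φ (centralGen a j.1)).tens.coeff i.1 = _
    rw [map_centralGen hφ]
    obtain ⟨⟨i₁, i₂⟩, hi⟩ := i
    obtain ⟨⟨j₁, j₂⟩, hj⟩ := j
    simp only at hi hj
    by_cases h : j₁ = j₂
    · simp [h, el, Finsupp.single_apply, eq_comm]
    · have : ¬ (i₁ = j₂ ∧ i₂ = j₁) := fun h' => h (le_antisymm hj (by rw [← h'.1, ← h'.2]; exact hi))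
      simp [h, el, Finsupp.single_apply, this, eq_comm]
  -- the map induced by `φ` on the quotient is injective
  let β : H →* Multiplicative (Alg D) :=
    { toFun := fun h => Multiplicative.ofAdd (φ h).base
      map_one' := by simp
      map_mul' := fun h h' => by
        rw [map_mul, TensorExt.mul_base, htriv]
        simp }
  have hβ : ∀ z ∈ Z, β z = 1 := fun z hz => congrArg Multiplicative.ofAdd (hZφ z hz)
  let a' : D → H ⧸ Z := fun d => (a d : H ⧸ Z)
  have hgen : ∀ i j, i ≤ j → centralGen a (i, j) ∈ Z := fun i j h =>
    Subgroup.subset_closure ⟨⟨(i, j), h⟩, rfl⟩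
  have hc : ∀ i j, i < j → Commute (a' i) (a' j) := fun i j h => by
    refine (comm_mem_iff_commute Z _ _).1 ?_
    simpa [centralGen, h.ne] using hgen i j h.le
  have hf₂ := injective_of_linearIndependent (a := a')
    (fun i j => by
      obtain h | rfl | h := lt_trichotomy i j
      · exact hc i j h
      · exact Commute.refl _
      · exact (hc j i h).symm)
    (fun i => (QuotientGroup.eq_one_iff (N := Z) _).2 (by simpa [centralGen] using hgen i i le_rfl))
    ((QuotientGroup.lift Z β hβ).comp (Subgroup.subtype _))
    (linearIndependent_of_coeff _ id fun i j => by
      change (φ (a j)).base.coeff i = _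
      rw [hφ]
      simp [el, Finsupp.single_apply, eq_comm])
  have htop' : Subgroup.closure (Set.range a') = ⊤ := by
    have := congrArg (Subgroup.map (QuotientGroup.mk' Z)) htop
    rwa [MonoidHom.map_closure, ← Set.range_comp,
      Subgroup.map_top_of_surjective _ (QuotientGroup.mk'_surjective Z)] at this
  rw [injective_iff_map_eq_one]
  intro h hh
  have hhZ : h ∈ Z := by
    have h₁ : (⟨(h : H ⧸ Z), htop' ▸ Subgroup.mem_top _⟩ : Subgroup.closure (Set.range a')) = 1 := by
      apply hf₂
      rw [map_one]
      change Multiplicative.ofAdd (φ h).base = 1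
      rw [hh]
      rfl
    exact (QuotientGroup.eq_one_iff h).1 (congrArg Subtype.val h₁)
  have h₂ : (⟨h, hhZ⟩ : Z) = 1 := by
    apply hf₁
    rw [map_one]
    change Multiplicative.ofAdd (φ h).tens = 1
    rw [hh]
    rfl
  exact congrArg Subtype.val h₂

/-- A criterion for a homomorphism to `TensorExt D` to be faithful. -/
theorem eq_one_of_map_eq_one {Γ : Type*} [Group Γ] {t : D →* Γ} {y : Γ} {f : Γ →* TensorExt D}
    (ht : ∀ d, f (t d) = TensorExt.ofTop d) (hy : f y = TensorExt.ofOne) {K Z : Subgroup Γ}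
    [hK : K.Normal] (hyK : y ∈ K) (hsq : ∀ h ∈ K, h ^ 2 ∈ Z) (hcomm : ∀ h ∈ K, ∀ h' ∈ K, comm h h' ∈ Z)
    (hcommute : ∀ z ∈ Z, ∀ h ∈ K, Commute z h) (hZ : ∀ z ∈ Z, z ^ 2 = 1)
    {g : Γ} (hg : g ∈ Subgroup.closure (insert y (Set.range t))) (hfg : f g = 1) : g = 1 := by
  let a : D → Γ := fun d => t d * y * (t d)⁻¹
  let H := Subgroup.closure (Set.range a)
  have haK : ∀ d, a d ∈ K := fun d => hK.conj_mem y hyK (t d)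
  have hHK : H ≤ K := by
    rw [Subgroup.closure_le]
    rintro _ ⟨d, rfl⟩
    exact haK d
  have haH : ∀ d, a d ∈ H := fun d => Subgroup.subset_closure ⟨d, rfl⟩
  have hconj : ∀ d, ∀ h ∈ H, t d * h * (t d)⁻¹ ∈ H := by
    intro d
    have : H ≤ H.comap (MulAut.conj (t d)).toMonoidHom := by
      rw [Subgroup.closure_le]
      rintro _ ⟨d', rfl⟩
      have := haH (d * d')
      simpa [a, mul_assoc] using this
    exact fun h hh => this hh
  -- Normal form of the semidirect product: `H` absorbs the conjugates of `y`, and comparing top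
  -- components then forces `d = 1`, which reduces the claim to `H`.
  have hdecomp : ∃ h ∈ H, ∃ d, g = h * t d := by
    clear hfg
    induction hg using Subgroup.closure_induction with
    | mem g hg =>
      obtain rfl | ⟨d, rfl⟩ := hg
      · exact ⟨g, by simpa [a] using haH 1, 1, by simp⟩
      · exact ⟨1, one_mem _, d, by simp⟩
    | one => exact ⟨1, one_mem _, 1, by simp⟩
    | mul g g' _ _ ih ih' =>
      obtain ⟨h, hh, d, rfl⟩ := ih
      obtain ⟨h', hh', d', rfl⟩ := ih'
      exact ⟨h * (t d * h' * (t d)⁻¹), mul_mem hh (hconj d h' hh'), d * d', by simp [mul_assoc]⟩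
    | inv g _ ih =>
      obtain ⟨h, hh, d, rfl⟩ := ih
      exact ⟨t d⁻¹ * h⁻¹ * (t d⁻¹)⁻¹, hconj d⁻¹ _ (inv_mem hh), d⁻¹, by simp⟩
  have hfa : ∀ d, f (a d) = ⟨el d, 0, 1⟩ := fun d => by
    simp only [a, map_mul, map_inv, ht, hy]
    ext1 <;> simp [TensorExt.ofTop, TensorExt.ofOne]
  obtain ⟨h, hh, d, rfl⟩ := hdecomp
  have hd : d = 1 := by
    have hH : H ≤ (TensorExt.topHom.comp f).ker := by
      rw [Subgroup.closure_le]
      rintro _ ⟨d, rfl⟩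
      exact congrArg TensorExt.top (hfa d)
    have h₁ := congrArg TensorExt.top hfg
    have h₂ : (f h).top = 1 := hH hh
    rw [map_mul, ht, TensorExt.mul_top, h₂, one_mul] at h₁
    exact h₁
  rw [hd, map_one, mul_one] at hfg ⊢
  have hcen : ∀ (z : H), (z : Γ) ∈ Z → z ∈ Subgroup.center H := fun z hz =>
    Subgroup.mem_center_iff.2 fun h => Subtype.ext (hcommute z hz h (hHK h.2)).symm
  have hinj := injective_of_central (H := H) (a := fun d => ⟨a d, haH d⟩)
    (φ := f.comp H.subtype) (by
      rw [← Subgroup.closure_closure_coe_preimage (k := Set.range a)]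
      congr 1
      ext ⟨g, hg⟩
      simp [Subtype.ext_iff])
    (fun d => hcen _ (hsq _ (haK d))) (fun d => Subtype.ext (hZ _ (hsq _ (haK d))))
    (fun d d' => hcen _ (hcomm _ (haK d) _ (haK d')))
    (fun d d' => Subtype.ext (hZ _ (hcomm _ (haK d) _ (haK d')))) hfa
  have h₁ : (⟨h, hh⟩ : H) = 1 := by
    apply hinj
    rw [map_one]
    exact hfg
  exact congrArg Subtype.val h₁

end Recognition

/-! ### Approximating elements of the free pro-`2` group by words -/

section Topology

lemma exists_inf_two_power (M N : TwoPowerNormal) :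
    (M.1 ⊓ N.1).Normal ∧ ∃ m : ℕ, (M.1 ⊓ N.1).index = 2 ^ m := by
  refine ⟨inferInstance, ?_⟩
  obtain ⟨m, hm⟩ := M.2.2
  obtain ⟨n, hn⟩ := N.2.2
  have h₁ : (M.1 ⊓ N.1).relIndex N.1 * N.1.index = (M.1 ⊓ N.1).index :=
    Subgroup.relIndex_mul_index inf_le_right
  have h₂ : (M.1 ⊓ N.1).index ∣ 2 ^ (m + n) := by
    rw [← h₁, Subgroup.inf_relIndex_right, pow_add, ← hm, ← hn]
    exact Nat.mul_dvd_mul_right (Subgroup.relIndex_dvd_index_of_normal _ _) _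
  obtain ⟨l, -, hl⟩ := (Nat.dvd_prime_pow Nat.prime_two).1 h₂
  exact ⟨l, hl⟩

lemma exists_le_of_finset (s : Finset TwoPowerNormal) :
    ∃ M : TwoPowerNormal, ∀ N ∈ s, M.1 ≤ N.1 := by
  classical
  induction s using Finset.induction_on with
  | empty => exact ⟨⟨⊤, inferInstance, 0, by simp⟩, by simp⟩
  | insert N s _ ih =>
    obtain ⟨M, hM⟩ := ih
    refine ⟨⟨M.1 ⊓ N.1, exists_inf_two_power M N⟩, fun L hL => ?_⟩
    obtain rfl | hL := Finset.mem_insert.1 hL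
    · exact inf_le_right
    · exact inf_le_left.trans (hM L hL)

lemma apply_eq_of_apply_eq {f : F} {w : E} {M N : TwoPowerNormal} (h : M.1 ≤ N.1)
    (hw : f.1 M = (w : E ⧸ M.1)) : f.1 N = (w : E ⧸ N.1) := by
  rw [← f.2 M N h, hw]
  rfl

lemma exists_apply_eq (f : F) (s : Finset TwoPowerNormal) :
    ∃ w : E, ∀ N ∈ s, f.1 N = (w : E ⧸ N.1) := by
  obtain ⟨M, hM⟩ := exists_le_of_finset s
  obtain ⟨w, hw⟩ := QuotientGroup.mk_surjective (f.1 M)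
  exact ⟨w, fun N hN => apply_eq_of_apply_eq (hM N hN) hw.symm⟩

lemma denseRange_ι : DenseRange ι := by
  rw [DenseRange, dense_iff_inter_open]
  rintro U hU ⟨f, hf⟩
  obtain ⟨V, hV, rfl⟩ := isOpen_induced_iff.1 hU
  obtain ⟨s, u, hu, hs⟩ := isOpen_pi_iff.1 hV f.1 hf
  obtain ⟨w, hw⟩ := exists_apply_eq f s
  refine ⟨ι w, hs fun N hN => ?_, w, rfl⟩
  change (w : E ⧸ N.1) ∈ u N
  rw [← hw N hN]
  exact (hu N hN).2

lemma lift_apply_eq {P : Type*} [Group P] [Finite P] (hP : IsPGroup 2 P) (φ : E →* P) {f : F}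
    {w : E} (hw : f.1 (kerTwo hP φ) = (w : E ⧸ (kerTwo hP φ).1)) : lift hP φ f = φ w :=
  congrArg (QuotientGroup.kerLift φ) hw

lemma lift_comp {P Q : Type*} [Group P] [Finite P] [Group Q] [Finite Q] (hP : IsPGroup 2 P)
    (hQ : IsPGroup 2 Q) (φ : E →* P) (ρ : P →* Q) :
    lift hQ (ρ.comp φ) = ρ.comp (lift hP φ) := by
  refine MonoidHom.ext fun f => ?_
  obtain ⟨w, hw⟩ := QuotientGroup.mk_surjective (f.1 (kerTwo hP φ))
  have hle : (kerTwo hP φ).1 ≤ (kerTwo hQ (ρ.comp φ)).1 := fun v (hv : φ v = 1) => by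
    change ρ (φ v) = 1
    rw [hv, map_one]
  rw [lift_apply_eq hQ _ (apply_eq_of_apply_eq hle hw.symm), MonoidHom.comp_apply,
    MonoidHom.comp_apply, lift_apply_eq hP φ hw.symm]

end Topology

/-! ### Identification of `G k` with a subgroup of the model group -/

section Presentation

/-- The cyclic group of order `2 ^ k`. -/
abbrev Cyc (k : ℕ) : Type := Multiplicative (ZMod (2 ^ k))

/-- The standard generator of the cyclic group. -/
def cycGen (k : ℕ) : Cyc k := Multiplicative.ofAdd 1

instance (k : ℕ) : Finite (Cyc k) :=
  have : NeZero (2 ^ k) := ⟨by positivity⟩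
  inferInstanceAs (Finite (ZMod (2 ^ k)))

lemma orderOf_cycGen (k : ℕ) : orderOf (cycGen k) = 2 ^ k := by
  rw [cycGen, orderOf_ofAdd_eq_addOrderOf, ZMod.addOrderOf_one]

lemma exists_cycGen_pow_eq (k : ℕ) (d : Cyc k) : ∃ n : ℕ, d = cycGen k ^ n := by
  have : NeZero (2 ^ k) := ⟨by positivity⟩
  refine ⟨(Multiplicative.toAdd d).val, ?_⟩
  rw [cycGen, ← ofAdd_nsmul]
  simp

lemma isPGroup_tensorExt (k : ℕ) : IsPGroup 2 (TensorExt (Cyc k)) :=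
  TensorExt.isPGroup (IsPGroup.of_card (n := k) (Nat.card_zmod (2 ^ k)))

/-- The homomorphism `a ↦ τ`, `b ↦ 1` on the abstract free group. -/
def freeRep (k : ℕ) : E →* TensorExt (Cyc k) :=
  FreeGroup.lift ![TensorExt.ofTop (cycGen k), TensorExt.ofOne]

/-- The continuous homomorphism `a ↦ τ`, `b ↦ 1` on `F₂`. -/
def proRep (k : ℕ) : F →* TensorExt (Cyc k) := lift (isPGroup_tensorExt k) (freeRep k)

lemma proRep_a (k : ℕ) : proRep k a = TensorExt.ofTop (cycGen k) := by
  rw [proRep, a, lift_ι, freeRep]; simp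

lemma proRep_b (k : ℕ) : proRep k b = TensorExt.ofOne := by
  rw [proRep, b, lift_ι, freeRep]; simp

/-- This reads off `R k` and `Y k` in the model: zero base and trivial top for the former, trivial
top for the latter. -/
lemma toW_eq (k : ℕ) : toW k = TensorExt.toWreath.comp (proRep k) := by
  rw [proRep, ← lift_comp _ (isPGroup_W k), toW]
  congr 1
  refine FreeGroup.ext_hom _ _ fun i => ?_
  fin_cases i
  · simp [freeRep]
    rfl
  · simp [freeRep]
    refine RegularWreathProduct.ext ?_ rfl
    funext d
    classical
    change Pi.mulSingle (M := fun _ => Multiplicative (ZMod 2)) 1 (Multiplicative.ofAdd 1) d =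
      Multiplicative.ofAdd ((1 : Alg (Cyc k)).coeff d)
    rw [MonoidAlgebra.one_def, MonoidAlgebra.coeff_single, Finsupp.single_apply, Pi.mulSingle_apply]
    by_cases h : d = 1
    · simp [h]
    · simp [h, Ne.symm h]

lemma proRep_of_mem_R {k : ℕ} {r : F} (hr : r ∈ R k) :
    (proRep k r).base = 0 ∧ (proRep k r).top = 1 := by
  rw [R, MonoidHom.mem_ker, toW_eq, MonoidHom.comp_apply] at hr
  exact TensorExt.toWreath_eq_one_iff.1 hr

lemma proRep_of_mem_Y {k : ℕ} {g : F} (hg : g ∈ Y k) : (proRep k g).top = 1 := by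
  rw [Y, Subgroup.mem_comap, toW_eq, B, MonoidHom.mem_ker] at hg
  exact hg

lemma N_le_ker_proRep (k : ℕ) : N k ≤ (proRep k).ker := by
  have hclosed : IsClosed ((proRep k).ker : Set F) :=
    Subgroup.isClosed_of_isOpen _ (isOpen_ker_lift _ _)
  refine Subgroup.topologicalClosure_minimal _ (sup_le (sup_le ?_ ?_) ?_) hclosed
  · refine commutator_le_of_comm_mem fun r hr g hg => ?_
    obtain ⟨h₁, h₂⟩ := proRep_of_mem_R hr
    rw [MonoidHom.mem_ker, map_comm, IsTensorRep.comm_eq_of_base_eq_zero h₁ h₂,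
      proRep_of_mem_Y hg]
    ext1 <;> simp
  · rw [powSubgroup, Subgroup.closure_le]
    rintro _ ⟨r, hr, rfl⟩
    obtain ⟨h₁, h₂⟩ := proRep_of_mem_R hr
    rw [SetLike.mem_coe, MonoidHom.mem_ker, map_pow, TensorExt.sq_eq h₂, h₁]
    ext1 <;> simp
  · refine Subgroup.normalClosure_le_normal ?_
    rw [Set.singleton_subset_iff, SetLike.mem_coe, MonoidHom.mem_ker, map_pow, proRep_a,
      TensorExt.ofTop_pow, orderOf_dvd_iff_pow_eq_one.1 (orderOf_cycGen k).dvd]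
    rfl

/-- The representation of `G_k` induced by `proRep k`. -/
def rep (k : ℕ) : G k →* TensorExt (Cyc k) :=
  QuotientGroup.lift (N k) (proRep k) fun _ hg => N_le_ker_proRep k hg

lemma rep_x (k : ℕ) : rep k (x k) = TensorExt.ofTop (cycGen k) := proRep_a k

lemma rep_y (k : ℕ) : rep k (y k) = TensorExt.ofOne := proRep_b k

lemma B_sq {k : ℕ} {w : W k} (hw : w ∈ B k) : w ^ 2 = 1 := by
  have hw' : w.right = 1 := hw
  rw [pow_two]
  refine RegularWreathProduct.ext ?_ (by simp [hw'])
  funext d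
  simp only [RegularWreathProduct.mul_left, hw', inv_one, one_mul]
  exact CharTwo.add_self_eq_zero (R := ZMod 2) _

lemma B_comm {k : ℕ} {w w' : W k} (hw : w ∈ B k) (hw' : w' ∈ B k) : comm w w' = 1 := by
  have h₁ := B_sq (mul_mem hw hw')
  have h₂ := B_sq hw
  have h₃ := B_sq hw'
  have e₂ : w⁻¹ = w := inv_eq_of_mul_eq_one_left (by rwa [pow_two] at h₂)
  have e₃ : w'⁻¹ = w' := inv_eq_of_mul_eq_one_left (by rwa [pow_two] at h₃)
  rw [comm, e₂, e₃, mul_assoc, ← pow_two, h₁]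

lemma mem_N_of_mem {k : ℕ} {g : F}
    (hg : g ∈ ⁅R k, Y k⁆ ⊔ powSubgroup (R k) 2 ⊔ Subgroup.normalClosure {a ^ 2 ^ k}) : g ∈ N k :=
  Subgroup.le_topologicalClosure _ hg

lemma x_pow_eq_one (k : ℕ) : x k ^ 2 ^ k = 1 :=
  (QuotientGroup.eq_one_iff (N := N k) (a ^ 2 ^ k)).2 (mem_N_of_mem
    (Subgroup.mem_sup_right (Subgroup.subset_normalClosure rfl)))

/-- The homomorphism from the cyclic group to `G_k` that maps the generator to `x_k`. -/
def cycHom (k : ℕ) : Cyc k →* G k :=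
  AddMonoidHom.toMultiplicativeLeft (ZMod.lift (2 ^ k)
    ⟨zmultiplesHom (Additive (G k)) (Additive.ofMul (x k)), by
      rw [zmultiplesHom_apply, natCast_zsmul, ← ofMul_pow, x_pow_eq_one, ofMul_one]⟩)

lemma cycHom_cycGen (k : ℕ) : cycHom k (cycGen k) = x k := by
  change Additive.toMul (ZMod.lift (2 ^ k) _ (1 : ZMod (2 ^ k))) = x k
  rw [← Int.cast_one, ZMod.lift_coe, zmultiplesHom_apply, one_zsmul, toMul_ofMul]

lemma rep_cycHom (k : ℕ) (d : Cyc k) : rep k (cycHom k d) = TensorExt.ofTop d := by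
  obtain ⟨n, rfl⟩ := exists_cycGen_pow_eq k d
  rw [map_pow, map_pow, cycHom_cycGen, rep_x, TensorExt.ofTop_pow]

/-- The restriction to the abstract subgroup generated by `x k` and `y k` is removed only
afterwards, by density; generation of `G k` is itself deduced from injectivity. -/
lemma eq_one_of_rep_eq_one {k : ℕ} {g : G k} (hg : g ∈ Subgroup.closure {x k, y k})
    (h : rep k g = 1) : g = 1 := by
  have hK : ((Y k).map (QuotientGroup.mk' (N k))).Normal :=
    Subgroup.Normal.map inferInstance _ (QuotientGroup.mk'_surjective _)
  have hsub : Subgroup.closure {x k, y k} ≤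
      Subgroup.closure (insert (y k) (Set.range (cycHom k))) := by
    refine Subgroup.closure_mono ?_
    rintro _ (rfl | rfl)
    · exact Or.inr ⟨cycGen k, cycHom_cycGen k⟩
    · exact Or.inl rfl
  refine eq_one_of_map_eq_one (rep_cycHom k) (rep_y k)
    (K := (Y k).map (QuotientGroup.mk' (N k))) (Z := (R k).map (QuotientGroup.mk' (N k)))
    ⟨b, ?_, rfl⟩ ?_ ?_ ?_ ?_ (hsub hg) h
  · change toW k b ∈ B k
    rw [toW_b]
    rfl
  · rintro _ ⟨g, hg, rfl⟩
    exact ⟨g ^ 2, by rw [SetLike.mem_coe, R, MonoidHom.mem_ker, map_pow, B_sq hg], rfl⟩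
  · rintro _ ⟨g, hg, rfl⟩ _ ⟨g', hg', rfl⟩
    exact ⟨comm g g', by
      rw [SetLike.mem_coe, R, MonoidHom.mem_ker, ← B_comm hg hg']
      simp [comm], rfl⟩
  · rintro _ ⟨r, hr, rfl⟩ _ ⟨g, hg, rfl⟩
    exact (comm_mem_iff_commute (N k) r g).1 (mem_N_of_mem (Subgroup.mem_sup_left
      (Subgroup.mem_sup_left (comm_mem_commutator hr hg))))
  · rintro _ ⟨r, hr, rfl⟩
    exact (QuotientGroup.eq_one_iff (N := N k) (r ^ 2)).2 (mem_N_of_mem (Subgroup.mem_sup_left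
      (Subgroup.mem_sup_right (Subgroup.subset_closure ⟨r, hr, rfl⟩))))

lemma mk_ι_mem_closure (k : ℕ) (w : E) :
    (QuotientGroup.mk (ι w) : G k) ∈ Subgroup.closure {x k, y k} := by
  have : (⊤ : Subgroup E) ≤
      (Subgroup.closure {x k, y k}).comap ((QuotientGroup.mk' (N k)).comp ι) := by
    rw [← FreeGroup.closure_range_of, Subgroup.closure_le]
    rintro _ ⟨i, rfl⟩
    fin_cases i
    · exact Subgroup.subset_closure (Or.inl rfl)
    · exact Subgroup.subset_closure (Or.inr rfl)
  exact this (Subgroup.mem_top w)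

/-- The kernel is open, so words are dense in it; words in the kernel lie in `N k`, which is closed.
-/
lemma ker_proRep_le_N (k : ℕ) : (proRep k).ker ≤ N k := by
  have h₁ : ((proRep k).ker : Set F) ⊆ closure ((proRep k).ker ∩ Set.range ι) :=
    denseRange_ι.open_subset_closure_inter (isOpen_ker_lift _ _)
  have h₂ : IsClosed (N k : Set F) := Subgroup.isClosed_topologicalClosure _
  refine h₁.trans (closure_minimal ?_ h₂)
  rintro _ ⟨hg, w, rfl⟩
  exact (QuotientGroup.eq_one_iff (ι w)).1 (eq_one_of_rep_eq_one (mk_ι_mem_closure k w) hg)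

lemma rep_injective (k : ℕ) : Function.Injective (rep k) := by
  rw [injective_iff_map_eq_one]
  intro g hg
  obtain ⟨g, rfl⟩ := QuotientGroup.mk_surjective g
  exact (QuotientGroup.eq_one_iff g).2 (ker_proRep_le_N k hg)

/-- The value of `rep k` depends on a single finite quotient of the free group, where every element
is represented by a word; injectivity then turns equal values into equal elements. -/
lemma closure_x_y (k : ℕ) : Subgroup.closure {x k, y k} = ⊤ := by
  rw [eq_top_iff]
  rintro g -
  obtain ⟨f, rfl⟩ := QuotientGroup.mk_surjective g
  obtain ⟨w, hw⟩ := QuotientGroup.mk_surjective (f.1 (kerTwo (isPGroup_tensorExt k) (freeRep k)))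
  have h : rep k (QuotientGroup.mk f) = rep k (QuotientGroup.mk (ι w)) :=
    lift_apply_eq (isPGroup_tensorExt k) (freeRep k) hw.symm
  rw [rep_injective k h]
  exact mk_ι_mem_closure k w

lemma isTensorRep {k : ℕ} (hk : 1 ≤ k) : IsTensorRep k (cycGen k) (x k) (y k) (rep k) where
  one_le := hk
  orderOf_eq := orderOf_cycGen k
  exists_pow_eq := exists_cycGen_pow_eq k
  closure_eq_top := closure_x_y k
  map_x := rep_x k
  map_y := rep_y k
  injective := rep_injective k

lemma c_eq_leftComm (k i : ℕ) : c k i = leftComm (y k) (x k) i := by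
  match i with
  | 0 => rfl
  | 1 => rfl
  | i + 2 => exact congrArg (comm · (x k)) (c_eq_leftComm k (i + 1))

end Presentation

end ProTwo

end

/-! ### The theorem -/

theorem mainTheorem4 (k : ℕ) (hk : 1 ≤ k) :
    ProTwo.LowerPSeriesHasLength 2 (ProTwo.G k) (2 ^ (k + 1) - 1) ∧
    ProTwo.lowerPSeries 2 (ProTwo.G k) 1 = ⊤ ∧
    ProTwo.lowerPSeries 2 (ProTwo.G k) 2 =
      Subgroup.closure {ProTwo.x k ^ 2, ProTwo.y k ^ 2} ⊔ ProTwo.γ (ProTwo.G k) 2 ∧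
    (∀ i : ℕ, 3 ≤ i → i ≤ 2 ^ (k - 1) + 1 →
      ProTwo.lowerPSeries 2 (ProTwo.G k) i =
        Subgroup.closure {ProTwo.x k ^ 2 ^ (i - 1), ProTwo.c k (i - 1) ^ 2} ⊔
          ProTwo.γ (ProTwo.G k) i) ∧
    (∀ i : ℕ, 2 ^ (k - 1) + 2 ≤ i → i ≤ 2 ^ (k + 1) →
      ProTwo.lowerPSeries 2 (ProTwo.G k) i =
        Subgroup.closure {ProTwo.x k ^ 2 ^ (i - 1)} ⊔ ProTwo.γ (ProTwo.G k) i) := by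
  have S := ProTwo.isTensorRep hk
  have hP : ∀ i : ℕ, 1 ≤ i → ProTwo.lowerPSeries 2 (ProTwo.G k) (i + 1) =
      Subgroup.closure {ProTwo.x k ^ 2 ^ i, ProTwo.c k i ^ 2} ⊔ ProTwo.γ (ProTwo.G k) (i + 1) :=
    fun i hi => by
      rw [S.isCyclicExtension.lowerPSeries_eq hi, ProTwo.sqSubgroup, ProTwo.c_eq_leftComm,
        Set.insert_eq, Subgroup.closure_union, sup_assoc]
  have hr : 1 ≤ 2 ^ (k - 1) := Nat.one_le_two_pow
  refine ⟨S.lowerPSeriesHasLength, rfl, hP 1 le_rfl, fun i hi _ => ?_, fun i hi _ => ?_⟩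
  · obtain ⟨i, rfl⟩ := Nat.exists_eq_add_of_le' (show 1 ≤ i by omega)
    exact hP i (by omega)
  · obtain ⟨i, rfl⟩ := Nat.exists_eq_add_of_le' (show 1 ≤ i by omega)
    rw [S.isCyclicExtension.lowerPSeries_eq (by omega), S.sqSubgroup_eq_γ (by omega),
      Nat.add_sub_cancel]
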